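/- For $\kappa>0$ let $I_0(\kappa)=\frac1{2\pi}\int_0^{2\pi}e^{\kappa\cos u}\,du$, $I_1(\kappa)=\frac1{2\pi}\int_0^{2\pi}\cos u\,e^{\kappa\cos u}\,du$, $A(\kappa)=I_1(\kappa)/I_0(\kappa)$ and $R(\kappa)=I_0(2\kappa)/I_0(\kappa)^2$. The von Mises distribution with location $\theta$ and concentration $\kappa$ has density $\frac{1}{2\pi I_0(\kappa)}e^{\kappa\cos(x-\theta)}$ on $[0,2\pi)$. **Model.** Angles $X=(X_e)$, indexed by the edges $e=\{i,j\}$, $1\le i<j\le n$, of the complete graph on $[n]$, are observed. For $C\subseteq[n]$ let $E(C)$ be the set of edges with both end-points in $C$. Under $H_0$ (law $\mathbb Q$) the $X_e$ are i.i.d. uniform on $[0,2\pi)$. Under $H_1$ (law $\mathbb P$) a community $C^*$ is uniform among the subsets of $[n]$ of size $k$ and, independently, a phase $\Theta^*$ is uniform on $[0,2\pi)$; given $(C^*,\Theta^*)$ the $X_e$ are independent, von Mises with location $\Theta^*$ and concentration $\kappa$ if $e\in E(C^*)$ and uniform on $[0,2\pi)$ otherwise. A test is a measurable map $\phi$ from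 the data to $\{0,1\}$, with $p_{\mathrm{fa}}(\phi)=\mathbb Q\{\phi(X)=1\}$ and $p_{\mathrm{miss}}(\phi)=\mathbb P\{\phi(X)=0\}$. A sequence of tests $(\phi_n)$ achieves strong detection if $p_{\mathrm{fa}}(\phi_n)\to0$ and $p_{\mathrm{miss}}(\phi_n)\to0$ as $n\to\infty$. Weak detection is impossible if $p_{\mathrm{fa}}(\phi_n)+p_{\mathrm{miss}}(\phi_n)\ge 1-o(1)$ for every sequence of tests $(\phi_n)$. The interval test with window length $2\pi\tau$ rejects $H_0$ if there are a $\theta\in[0,2\pi)$ and a $C\subseteq[n]$ with $|C|=k$ such that $X_e\in[\theta,\theta+2\pi\tau]$ (mod $2\pi$) for all $e\in E(C)$. The coherence test with threshold $\beta$ rejects $H_0$ if $\max_{C\subseteq[n],\,|C|=k}\big|\sum_{e\in E(C)}e^{\mathrm i X_e}\big|\ge\beta$. **Theorem.** (a) (Achievability) For all $2\le k\le n$, $\kappa>0$ and $\tau\in(0,1)$ the interval test with window length $2\pi\tau$ satisfies $$p_{\mathrm{fa}}\le \exp\left(\log\frac{\binom k2}{\tau}+k\left\{\log\frac nk+1+\frac{k-1}{2}\log\tau\right\}\right),\qquad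 p_{\mathrm{miss}}\le\binom k2\cdot\frac{2\exp\{(\cos(\pi\tau)-1)\kappa\}}{\pi\, I_0(\kappa)\,e^{-\kappa}\,\kappa\,|\sin(\pi\tau)|}.$$ Thus, if $k$, $\kappa$, $\tau$ depend on $n$ and both right-hand sides converge to $0$ as $n\to\infty$, strong detection is achieved by the interval test. Moreover, for all $1\le k\le n$, $\kappa>0$, every integer $B\ge3$ and every $\epsilon\in(0,1)$, the coherence test with threshold $\beta=(1-\epsilon/4)\binom k2A(\kappa)$ satisfies $$p_{\mathrm{fa}}\le B\exp\left\{k\left(\log\frac{ne}{k}-\frac{(1-\epsilon/4)^2(k-1)A^2(\kappa)\cos^2(\pi/B)}{2}\right)\right\},\qquad p_{\mathrm{miss}}\le\exp\left(-\frac{\epsilon^2\binom k2A^2(\kappa)}{32}\right).$$ Thus, if $k$, $\kappa$, $B$, $\epsilon$ depend on $n$ and both right-hand sides converge to $0$ as $n\to\infty$, strong detection is achieved by the coherence test. (b) (Converse) Let $k=k_n$ and $\kappa=\kappa_n$ with $1\le k_n\le n$ and $\kappa_n>0$. If $$\frac{k^2}{n}\left(\exp\left(\frac{(k-1)\log R(\kappa)}{2}\right)-1\right)\xrightarrow[n\to\infty]{}0,$$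 then weak detection is impossible. -/

import Mathlib

open Filter Topology MeasureTheory
open scoped ENNReal

noncomputable section

namespace VonMisesCommunity

/-- Modified Bessel function of the first kind of order zero. -/
def besselI0 (κ : ℝ) : ℝ :=
  (1 / (2 * Real.pi)) * ∫ u in (0 : ℝ)..(2 * Real.pi), Real.exp (κ * Real.cos u)

/-- Modified Bessel function of the first kind of order one. -/
def besselI1 (κ : ℝ) : ℝ :=
  (1 / (2 * Real.pi)) * ∫ u in (0 : ℝ)..(2 * Real.pi), Real.cos u * Real.exp (κ * Real.cos u)

/-- `A(κ) = I₁(κ) / I₀(κ)`. -/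
def ratioA (κ : ℝ) : ℝ := besselI1 κ / besselI0 κ

/-- `R(κ) = I₀(2κ) / I₀(κ)²`. -/
def ratioR (κ : ℝ) : ℝ := besselI0 (2 * κ) / besselI0 κ ^ 2

/-- The uniform distribution on `[0, 2π)`. -/
def uniformAngle : Measure ℝ :=
  (ENNReal.ofReal (2 * Real.pi))⁻¹ • volume.restrict (Set.Ico 0 (2 * Real.pi))

/-- The von Mises density with location `θ` and concentration `κ`. -/
def vonMisesDensity (θ κ x : ℝ) : ℝ :=
  1 / (2 * Real.pi * besselI0 κ) * Real.exp (κ * Real.cos (x - θ))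

/-- The von Mises distribution on `[0, 2π)` with location `θ` and concentration `κ`. -/
def vonMises (θ κ : ℝ) : Measure ℝ :=
  (volume.restrict (Set.Ico 0 (2 * Real.pi))).withDensity
    fun x => ENNReal.ofReal (vonMisesDensity θ κ x)

/-- Edges of the complete graph on `n` vertices, as ordered pairs `i < j`. -/
abbrev Edge (n : ℕ) : Type := {e : Fin n × Fin n // e.1 < e.2}

/-- The observed data: one angle for every edge. -/
abbrev Obs (n : ℕ) : Type := Edge n → ℝ

/-- `E(C)`: the edges with both end-points in `C`. -/
def edgesIn {n : ℕ} (C : Finset (Fin n)) : Finset (Edge n) :=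
  Finset.univ.filter fun e => e.1.1 ∈ C ∧ e.1.2 ∈ C

/-- The law of the data under the null hypothesis. -/
def nullLaw (n : ℕ) : Measure (Obs n) := Measure.pi fun _ => uniformAngle

/-- The law of the data given that the planted community is `C` and the planted phase is `θ`. -/
def plantedLawGiven {n : ℕ} (C : Finset (Fin n)) (κ θ : ℝ) : Measure (Obs n) :=
  Measure.pi fun e => if e ∈ edgesIn C then vonMises θ κ else uniformAngle

/-- The law of the data under the alternative: the community is uniform among the `k`-subsets of
the vertex set and, independently, the phase is uniform on `[0, 2π)`. -/
def plantedLaw (n k : ℕ) (κ : ℝ) : Measure (Obs n) :=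
  ∑ C ∈ (Finset.univ : Finset (Fin n)).powersetCard k,
    ((n.choose k : ℝ≥0∞))⁻¹ • uniformAngle.bind (plantedLawGiven C κ)

theorem besselI0_pos (κ : ℝ) : 0 < besselI0 κ := by
  unfold besselI0
  have : 0 < ∫ u in (0 : ℝ)..(2 * Real.pi), Real.exp (κ * Real.cos u) := by
    apply intervalIntegral.intervalIntegral_pos_of_pos
    · exact (by fun_prop : Continuous fun u => Real.exp (κ * Real.cos u)).intervalIntegrable _ _
    · intro u; positivity
    · positivity
  positivity

instance : IsProbabilityMeasure uniformAngle := by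
  constructor
  have h : (0 : ℝ) < 2 * Real.pi := by positivity
  simp only [uniformAngle, Measure.smul_apply, Measure.restrict_apply_univ, Real.volume_Ico,
    sub_zero, smul_eq_mul]
  exact ENNReal.inv_mul_cancel (by simpa using h) ENNReal.ofReal_ne_top

instance (θ κ : ℝ) : IsProbabilityMeasure (vonMises θ κ) := by
  constructor
  have hpi : (0 : ℝ) ≤ 2 * Real.pi := by positivity
  have hI := besselI0_pos κ
  have hc : Continuous fun x => vonMisesDensity θ κ x := by
    unfold vonMisesDensity; fun_prop
  rw [vonMises, withDensity_apply _ MeasurableSet.univ, Measure.restrict_univ,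
    ← ofReal_integral_eq_lintegral_ofReal]
  · have h1 : ∫ x in Set.Ico 0 (2 * Real.pi), vonMisesDensity θ κ x = 1 := by
      rw [integral_Ico_eq_integral_Ioc, ← intervalIntegral.integral_of_le hpi]
      unfold vonMisesDensity
      rw [intervalIntegral.integral_const_mul,
        intervalIntegral.integral_comp_sub_right (fun y => Real.exp (κ * Real.cos y)) θ]
      have hp : Function.Periodic (fun y => Real.exp (κ * Real.cos y)) (2 * Real.pi) := by
        intro y; simp
      have h2 := hp.intervalIntegral_add_eq (0 - θ) 0
      rw [zero_add, show 0 - θ + 2 * Real.pi = 2 * Real.pi - θ by ring] at h2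
      rw [h2]
      have h3 : ∫ u in (0 : ℝ)..(2 * Real.pi), Real.exp (κ * Real.cos u)
          = 2 * Real.pi * besselI0 κ := by
        unfold besselI0; field_simp
      rw [h3]
      have : 2 * Real.pi * besselI0 κ ≠ 0 := by positivity
      field_simp
    rw [h1]; simp
  · exact (hc.integrableOn_Icc).mono_set Set.Ico_subset_Icc_self
  · filter_upwards with x
    unfold vonMisesDensity
    positivity

theorem measurable_vonMises (κ : ℝ) : Measurable fun θ => vonMises θ κ := by
  refine Measure.measurable_of_measurable_coe _ fun s hs => ?_
  simp only [vonMises, withDensity_apply _ hs]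
  have hc : Continuous fun p : ℝ × ℝ => vonMisesDensity p.1 κ p.2 := by
    unfold vonMisesDensity; fun_prop
  exact (hc.measurable.ennreal_ofReal).lintegral_prod_right'

/-- The mixture over the phase in `plantedLaw` is taken over a measurable family. -/
theorem measurable_plantedLawGiven {n : ℕ} (C : Finset (Fin n)) (κ : ℝ) :
    Measurable (plantedLawGiven C κ) := by
  have hprob : ∀ θ, ∀ e : Edge n,
      IsProbabilityMeasure (if e ∈ edgesIn C then vonMises θ κ else uniformAngle) := by
    intro θ e; split_ifs <;> infer_instance
  have : ∀ θ, IsProbabilityMeasure (plantedLawGiven C κ θ) := by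
    intro θ; unfold plantedLawGiven; infer_instance
  refine Measurable.measure_of_isPiSystem_of_isProbabilityMeasure
    generateFrom_pi.symm isPiSystem_pi ?_
  rintro _ ⟨s, hs, rfl⟩
  simp only [plantedLawGiven, Measure.pi_pi]
  refine Finset.measurable_prod _ fun e _ => ?_
  have hse : MeasurableSet (s e) := hs e (Set.mem_univ e)
  by_cases he : e ∈ edgesIn C
  · simp only [he, if_true]
    exact (Measure.measurable_coe hse).comp (measurable_vonMises κ)
  · simp only [he, if_false]
    exact measurable_const

/-- False-alarm probability of a test `φ` (value `true` means that the null is rejected). -/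
def pFalseAlarm {n : ℕ} (Q : Measure (Obs n)) (φ : Obs n → Bool) : ℝ := Q.real {X | φ X = true}

/-- Miss probability of a test `φ`. -/
def pMiss {n : ℕ} (P : Measure (Obs n)) (φ : Obs n → Bool) : ℝ := P.real {X | φ X = false}

/-- The sequence `φ` consists of tests and achieves strong detection. -/
def AchievesStrongDetection (Q P : ∀ n, Measure (Obs n)) (φ : ∀ n, Obs n → Bool) : Prop :=
  (∀ n, Measurable (φ n)) ∧
    Tendsto (fun n => pFalseAlarm (Q n) (φ n)) atTop (𝓝 0) ∧
    Tendsto (fun n => pMiss (P n) (φ n)) atTop (𝓝 0)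

/-- For every sequence of tests, the two error probabilities add up to at least `1 - o(1)`. -/
def WeakDetectionImpossible (Q P : ∀ n, Measure (Obs n)) : Prop :=
  ∀ φ : ∀ n, Obs n → Bool, (∀ n, Measurable (φ n)) →
    ∀ δ > (0 : ℝ), ∀ᶠ n in atTop, 1 - δ ≤ pFalseAlarm (Q n) (φ n) + pMiss (P n) (φ n)

/-- The angle `x` lies in the arc `[θ, θ + 2πτ]` of the circle. -/
def InArc (θ τ x : ℝ) : Prop :=
  ∃ m : ℤ, x + 2 * Real.pi * m ∈ Set.Icc θ (θ + 2 * Real.pi * τ)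

open Classical in
/-- The community interval statistic. -/
def intervalStat {n : ℕ} (k : ℕ) (τ : ℝ) (X : Obs n) : ℝ :=
  ⨆ θ : Set.Ico (0 : ℝ) (2 * Real.pi), ⨆ C : {C : Finset (Fin n) // C.card = k},
    if ∀ e ∈ edgesIn C.1, InArc θ τ (X e) then (1 : ℝ) else 0

open Classical in
/-- The community interval test. -/
def intervalTest {n : ℕ} (k : ℕ) (τ : ℝ) (X : Obs n) : Bool := decide (intervalStat k τ X = 1)

/-- The coherence statistic: a maximum over the `k`-subsets of the vertex set. -/
def coherenceStat {n : ℕ} (k : ℕ) (X : Obs n) : ℝ :=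
  ⨆ C : {C : Finset (Fin n) // C.card = k},
    ‖∑ e ∈ edgesIn C.1, Complex.exp (Complex.I * (X e : ℂ))‖

open Classical in
/-- The coherence test with threshold `β`. -/
def coherenceTest {n : ℕ} (k : ℕ) (β : ℝ) (X : Obs n) : Bool := decide (β ≤ coherenceStat k X)

/-- The threshold `(1 - ε/4) (k choose 2) A(κ)` of the coherence test. -/
def coherenceThreshold (k : ℕ) (κ ε : ℝ) : ℝ := (1 - ε / 4) * (k.choose 2 : ℝ) * ratioA κ

/-- Bound for the false-alarm probability of the interval test. -/
def intervalFABound (n k : ℕ) (τ : ℝ) : ℝ :=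
  Real.exp (Real.log ((k.choose 2 : ℝ) / τ)
    + k * (Real.log ((n : ℝ) / k) + 1 + ((k : ℝ) - 1) / 2 * Real.log τ))

/-- Bound for the miss probability of the interval test. -/
def intervalMissBound (k : ℕ) (κ τ : ℝ) : ℝ :=
  (k.choose 2 : ℝ) * (2 * Real.exp ((Real.cos (Real.pi * τ) - 1) * κ)
    / (Real.pi * besselI0 κ * Real.exp (-κ) * κ * |Real.sin (Real.pi * τ)|))

/-- Bound for the false-alarm probability of the coherence test. -/
def coherenceFABound (n k : ℕ) (κ : ℝ) (B : ℕ) (ε : ℝ) : ℝ :=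
  B * Real.exp (k * (Real.log (n * Real.exp 1 / k)
    - (1 - ε / 4) ^ 2 * ((k : ℝ) - 1) * ratioA κ ^ 2 * Real.cos (Real.pi / B) ^ 2 / 2))

/-- Bound for the miss probability of the coherence test. -/
def coherenceMissBound (k : ℕ) (κ ε : ℝ) : ℝ :=
  Real.exp (-(ε ^ 2 * (k.choose 2 : ℝ) * ratioA κ ^ 2 / 32))

end VonMisesCommunity

end

open VonMisesCommunity

namespace VonMisesCommunity

/-! Part (a) rests on union bounds; write m = k(k-1)/2 for the number of edges in a community. For a
false alarm of the interval test, a window containing all the angles of E(C) can be slid until it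
opens at one of them. The continuum of windows thus becomes m choices (`exists_arc_iff_start`), and
given the opening angle the other m - 1 uniform angles fall into the window with probability at most
τ each. A miss forces some planted angle out of the window centred at the true phase; the von Mises
tail is integrated after replacing the cosine by a linear majorant (`cos_le_cos_sub`). For the
coherence test, one of B equispaced directions captures the fraction cos(π/B) of a modulus, so under
the null it suffices to control B sums of cosines. These have variance proxy 1/2 per edge because
I₀(t) ≤ exp(t²/4) (`besselI0_le`). Under the alternative, projecting on the true phase and applying
Hoeffding's inequality suffices.

Part (b) is a second-moment argument. Given two communities C, D and two phases, the null
expectation of the product of likelihood ratios factorises over edges. Only common edges contribute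
more than 1, and by the arithmetic-geometric mean inequality each contributes at most R(κ), whatever
the phases (`integral_relDensity_mul_le`). An overlap of s vertices has s(s-1)/2 ≤ s(k-1)/2 common
edges, so the second moment is at most the generating function of a hypergeometric overlap at x =
R^((k-1)/2). A binomial comparison bounds it by exp((k²/n)(x - 1)), which tends to 1, and
`mixture_measure_le` turns this into closeness of the two laws. -/

/-! ### Integrals against the uniform and von Mises laws -/

theorem integral_uniformAngle (f : ℝ → ℝ) :
    ∫ x, f x ∂uniformAngle = 1 / (2 * Real.pi) * ∫ x in (0 : ℝ)..(2 * Real.pi), f x := by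
  have hpi : (0 : ℝ) < 2 * Real.pi := by positivity
  rw [uniformAngle, integral_smul_measure, integral_Ico_eq_integral_Ioc,
    ← intervalIntegral.integral_of_le hpi.le, ENNReal.toReal_inv, ENNReal.toReal_ofReal hpi.le,
    smul_eq_mul, one_div]

theorem continuous_vonMisesDensity (θ κ : ℝ) : Continuous (vonMisesDensity θ κ) := by
  unfold vonMisesDensity; fun_prop

theorem vonMisesDensity_nonneg (θ κ x : ℝ) : 0 ≤ vonMisesDensity θ κ x := by
  have := besselI0_pos κ
  unfold vonMisesDensity; positivity

theorem integral_vonMises (θ κ : ℝ) (f : ℝ → ℝ) :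
    ∫ x, f x ∂(vonMises θ κ)
      = ∫ x in (0 : ℝ)..(2 * Real.pi), vonMisesDensity θ κ x * f x := by
  have hpi : (0 : ℝ) < 2 * Real.pi := by positivity
  rw [vonMises, integral_withDensity_eq_integral_toReal_smul
    (continuous_vonMisesDensity θ κ).measurable.ennreal_ofReal (by simp),
    intervalIntegral.integral_of_le hpi.le, integral_Ico_eq_integral_Ioc]
  refine integral_congr_ae (Eventually.of_forall fun x => ?_)
  simp [ENNReal.toReal_ofReal (vonMisesDensity_nonneg θ κ x)]

/-- Over a full period the starting point is irrelevant. -/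
theorem integral_period_shift {f : ℝ → ℝ} (hf : Function.Periodic f (2 * Real.pi)) (t : ℝ) :
    ∫ x in (0 : ℝ)..(2 * Real.pi), f (x + t) = ∫ x in (0 : ℝ)..(2 * Real.pi), f x := by
  rw [intervalIntegral.integral_comp_add_right]
  have := hf.intervalIntegral_add_eq t 0
  rw [zero_add] at this
  rw [← this]
  congr 1 <;> ring

/-- The expectation of a periodic function of the centred angle. -/
theorem integral_vonMises_centred (θ κ : ℝ) {f : ℝ → ℝ}
    (hf : Function.Periodic f (2 * Real.pi)) :
    ∫ x, f (x - θ) ∂(vonMises θ κ) = 1 / (2 * Real.pi * besselI0 κ) *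
      ∫ u in (0 : ℝ)..(2 * Real.pi), Real.exp (κ * Real.cos u) * f u := by
  rw [integral_vonMises, ← intervalIntegral.integral_const_mul,
    ← integral_period_shift (t := -θ) (f := fun u => 1 / (2 * Real.pi * besselI0 κ) *
      (Real.exp (κ * Real.cos u) * f u))]
  · simp [vonMisesDensity, sub_eq_add_neg, mul_assoc]
  · intro u
    simp [hf u]

/-! ### The planted law as an average over communities and phases -/

instance isProbabilityMeasure_edgeLaw {n : ℕ} (C : Finset (Fin n)) (κ θ : ℝ) (e : Edge n) :
    IsProbabilityMeasure (if e ∈ edgesIn C then vonMises θ κ else uniformAngle) := by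
  split_ifs <;> infer_instance

instance isProbabilityMeasure_plantedLawGiven {n : ℕ} (C : Finset (Fin n)) (κ θ : ℝ) :
    IsProbabilityMeasure (plantedLawGiven C κ θ) := by
  unfold plantedLawGiven; infer_instance

instance isProbabilityMeasure_nullLaw (n : ℕ) : IsProbabilityMeasure (nullLaw n) := by
  unfold nullLaw; infer_instance

theorem measurable_plantedLawGiven_real {n : ℕ} (C : Finset (Fin n)) (κ : ℝ) {s : Set (Obs n)}
    (hs : MeasurableSet s) : Measurable fun θ => (plantedLawGiven C κ θ).real s :=
  ((Measure.measurable_coe hs).comp (measurable_plantedLawGiven C κ)).ennreal_toReal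

theorem integrable_plantedLawGiven_real {n : ℕ} (C : Finset (Fin n)) (κ : ℝ) {s : Set (Obs n)}
    (hs : MeasurableSet s) :
    Integrable (fun θ => (plantedLawGiven C κ θ).real s) uniformAngle := by
  refine Integrable.of_bound (measurable_plantedLawGiven_real C κ hs).aestronglyMeasurable 1 ?_
  filter_upwards with θ
  rw [Real.norm_of_nonneg measureReal_nonneg]
  exact measureReal_le_one

theorem plantedLaw_real {n k : ℕ} (κ : ℝ) {s : Set (Obs n)} (hs : MeasurableSet s) :
    (plantedLaw n k κ).real s = ((n.choose k : ℝ))⁻¹ *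
      ∑ C ∈ (Finset.univ : Finset (Fin n)).powersetCard k,
        ∫ θ, (plantedLawGiven C κ θ).real s ∂uniformAngle := by
  have hb : ∀ C : Finset (Fin n), (uniformAngle.bind (plantedLawGiven C κ)) s
      = ENNReal.ofReal (∫ θ, (plantedLawGiven C κ θ).real s ∂uniformAngle) := by
    intro C
    rw [Measure.bind_apply hs (measurable_plantedLawGiven C κ).aemeasurable,
      ofReal_integral_eq_lintegral_ofReal (integrable_plantedLawGiven_real C κ hs)
        (Eventually.of_forall fun _ => measureReal_nonneg)]
    simp
  rw [measureReal_def, plantedLaw, Measure.finsetSum_apply, Finset.mul_sum]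
  simp only [Measure.smul_apply, hb, smul_eq_mul]
  -- For k > n the weight 0⁻¹ is infinite in `ℝ≥0∞`, but the sum is empty and both sides vanish.
  by_cases hc : n.choose k = 0
  · have : (Finset.univ : Finset (Fin n)).powersetCard k = ∅ := by
      rw [← Finset.card_eq_zero, Finset.card_powersetCard]; simpa using hc
    simp [this]
  rw [ENNReal.toReal_sum fun C _ => ENNReal.mul_ne_top (by simpa using hc) ENNReal.ofReal_ne_top]
  refine Finset.sum_congr rfl fun C _ => ?_
  rw [ENNReal.toReal_mul, ENNReal.toReal_ofReal (integral_nonneg fun _ => measureReal_nonneg)]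
  simp

/-- An average is at most a uniform bound, so miss probabilities need only be estimated for a fixed
community and phase. -/
theorem plantedLaw_real_le {n k : ℕ} {κ c : ℝ} (hk : k ≤ n) {s : Set (Obs n)}
    (hs : MeasurableSet s)
    (h : ∀ C : Finset (Fin n), C.card = k → ∀ θ, (plantedLawGiven C κ θ).real s ≤ c) :
    (plantedLaw n k κ).real s ≤ c := by
  have hpos : (0 : ℝ) < n.choose k := by exact_mod_cast Nat.choose_pos hk
  rw [plantedLaw_real κ hs, inv_mul_le_iff₀ hpos]
  calc _ ≤ ∑ C ∈ (Finset.univ : Finset (Fin n)).powersetCard k, c := by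
        refine Finset.sum_le_sum fun C hC => ?_
        calc _ ≤ ∫ _, c ∂uniformAngle :=
              integral_mono (integrable_plantedLawGiven_real C κ hs) (integrable_const _)
                fun θ => h C (Finset.mem_powersetCard.1 hC).2 θ
          _ = c := by simp
    _ = n.choose k * c := by simp

/-! ### Counting edges and subsets -/

theorem card_edgesIn {n : ℕ} (C : Finset (Fin n)) : (edgesIn C).card = C.card.choose 2 := by
  rw [← Finset.card_powersetCard]
  refine Finset.card_bij (fun e _ => {e.1.1, e.1.2}) ?_ ?_ ?_
  · intro e he
    simp only [edgesIn, Finset.mem_filter, Finset.mem_univ, true_and] at he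
    rw [Finset.mem_powersetCard]
    refine ⟨?_, Finset.card_pair e.2.ne⟩
    intro x hx
    simp only [Finset.mem_insert, Finset.mem_singleton] at hx
    rcases hx with rfl | rfl
    exacts [he.1, he.2]
  · rintro ⟨⟨a, b⟩, hab⟩ _ ⟨⟨c, d⟩, hcd⟩ _ h
    have hab' : a < b := hab
    have hcd' : c < d := hcd
    simp only [Subtype.mk.injEq, Prod.mk.injEq] at h ⊢
    have h1 : a ∈ ({c, d} : Finset (Fin n)) := by rw [← h]; simp
    have h2 : b ∈ ({c, d} : Finset (Fin n)) := by rw [← h]; simp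
    have h3 : c ∈ ({a, b} : Finset (Fin n)) := by rw [h]; simp
    simp only [Finset.mem_insert, Finset.mem_singleton] at h1 h2 h3
    omega
  · intro s hs
    obtain ⟨hs, hc⟩ := Finset.mem_powersetCard.1 hs
    obtain ⟨x, y, hxy, rfl⟩ := Finset.card_eq_two.1 hc
    have hx : x ∈ C := hs (by simp)
    have hy : y ∈ C := hs (by simp)
    rcases lt_or_gt_of_ne hxy with h | h
    · exact ⟨⟨(x, y), h⟩, by simp [edgesIn, hx, hy], rfl⟩
    · exact ⟨⟨(y, x), h⟩, by simp [edgesIn, hx, hy], Finset.pair_comm _ _⟩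

theorem edgesIn_inter {n : ℕ} (C D : Finset (Fin n)) :
    edgesIn (C ∩ D) = edgesIn C ∩ edgesIn D := by
  ext e
  simp only [edgesIn, Finset.mem_filter, Finset.mem_univ, true_and, Finset.mem_inter]
  tauto

/-- Combine C(n,k) ≤ n^k / k! with k^k / k! ≤ e^k, a single term of the exponential series. -/
theorem choose_le_mul_exp_div_pow {n k : ℕ} (hk : 1 ≤ k) :
    (n.choose k : ℝ) ≤ (n * Real.exp 1 / k) ^ k := by
  have hk0 : (0 : ℝ) < k := by exact_mod_cast hk
  have h1 := Nat.choose_le_pow_div (α := ℝ) k n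
  have h2 : (k : ℝ) ^ k / k.factorial ≤ Real.exp k := Real.pow_div_factorial_le_exp _ hk0.le k
  have hf : (0 : ℝ) < k.factorial := by exact_mod_cast k.factorial_pos
  refine h1.trans ?_
  rw [div_pow, mul_pow, ← Real.exp_nat_mul, mul_one, div_le_div_iff₀ hf (by positivity)]
  rw [div_le_iff₀ hf] at h2
  calc _ ≤ (n : ℝ) ^ k * (Real.exp k * k.factorial) := by gcongr
    _ = _ := by ring

theorem plantedLawGiven_real_eval {n : ℕ} (C : Finset (Fin n)) (κ θ : ℝ) {e : Edge n}
    (he : e ∈ edgesIn C) {s : Set ℝ} (hs : MeasurableSet s) :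
    (plantedLawGiven C κ θ).real {X | X e ∈ s} = (vonMises θ κ).real s := by
  have := (measurePreserving_eval
    (fun e : Edge n => if e ∈ edgesIn C then vonMises θ κ else uniformAngle) e)
  have h2 := this.measureReal_preimage hs.nullMeasurableSet
  simp only [he, if_true] at h2
  exact h2

/-! ### Arcs of the circle and the rejection event of the interval test -/

theorem inArc_add_two_pi {θ τ x : ℝ} : InArc θ τ (x + 2 * Real.pi) ↔ InArc θ τ x := by
  constructor
  · rintro ⟨m, hm⟩
    exact ⟨m + 1, by push_cast; convert hm using 1; ring⟩
  · rintro ⟨m, hm⟩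
    exact ⟨m - 1, by push_cast; convert hm using 1; ring⟩

theorem inArc_start_add_int {θ τ x : ℝ} (p : ℤ) :
    InArc (θ + 2 * Real.pi * p) τ x ↔ InArc θ τ x := by
  constructor
  · rintro ⟨m, h1, h2⟩
    exact ⟨m - p, by push_cast; linarith, by push_cast; linarith⟩
  · rintro ⟨m, h1, h2⟩
    exact ⟨m + p, by push_cast; linarith, by push_cast; linarith⟩

/-- An arc depends on its starting point only modulo 2π. Dropping the restriction to [0, 2π) lets
windows be slid freely. -/
theorem exists_arc_iff {ι : Type*} {s : Finset ι} {τ : ℝ} {x : ι → ℝ} :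
    (∃ θ : Set.Ico (0 : ℝ) (2 * Real.pi), ∀ e ∈ s, InArc θ τ (x e)) ↔
      ∃ θ : ℝ, ∀ e ∈ s, InArc θ τ (x e) := by
  have hpi : (0 : ℝ) < 2 * Real.pi := by positivity
  refine ⟨fun ⟨θ, h⟩ => ⟨θ, h⟩, fun ⟨θ, h⟩ => ?_⟩
  refine ⟨⟨toIcoMod hpi 0 θ, by simpa using toIcoMod_mem_Ico hpi 0 θ⟩, fun e he => ?_⟩
  rw [← inArc_start_add_int (toIcoDiv hpi 0 θ)]
  convert h e he using 1
  conv_rhs => rw [← toIcoMod_add_toIcoDiv_zsmul hpi 0 θ]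
  simp [mul_comm]

/-- A window containing a nonempty family of angles may be slid until it starts at one of them. -/
theorem exists_arc_iff_start {ι : Type*} {s : Finset ι} (hs : s.Nonempty) {τ : ℝ} {x : ι → ℝ} :
    (∃ θ : ℝ, ∀ e ∈ s, InArc θ τ (x e)) ↔ ∃ a ∈ s, ∀ e ∈ s, InArc (x a) τ (x e) := by
  refine ⟨fun ⟨θ, h⟩ => ?_, fun ⟨a, _, h⟩ => ⟨x a, h⟩⟩
  choose! m hm using h
  -- Each angle is lifted to a representative inside the window; the smallest lift opens the new
  -- window, and no lift exceeds the old right end.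
  obtain ⟨a, ha, hmin⟩ := s.exists_min_image (fun e => x e + 2 * Real.pi * m e) hs
  refine ⟨a, ha, fun e he => ?_⟩
  rw [← inArc_start_add_int (m a)]
  exact ⟨m e, hmin e he, (hm e he).2.trans (by linarith [(hm a ha).1])⟩

/-- A real supremum over an empty type is 0, which agrees with the false branch, so no nonemptiness
is needed. -/
theorem iSup_indicator {ι : Type*} (p : ι → Prop) [DecidablePred p] [Decidable (∃ i, p i)] :
    (⨆ i, if p i then (1 : ℝ) else 0) = if ∃ i, p i then 1 else 0 := by
  split_ifs with h
  · obtain ⟨i, hi⟩ := h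
    refine le_antisymm ?_ ?_
    · have : Nonempty ι := ⟨i⟩
      exact ciSup_le fun j => by split_ifs <;> norm_num
    · refine le_ciSup_of_le ⟨1, ?_⟩ i (by simp [hi])
      rintro _ ⟨j, rfl⟩
      dsimp only
      split_ifs <;> norm_num
  · push Not at h
    simp [h]

theorem intervalTest_eq_true_iff {n k : ℕ} {τ : ℝ} {X : Obs n} :
    intervalTest k τ X = true ↔
      ∃ C : Finset (Fin n), C.card = k ∧ ∃ θ : ℝ, ∀ e ∈ edgesIn C, InArc θ τ (X e) := by
  classical
  have h : intervalStat k τ X = if ∃ θ : Set.Ico (0 : ℝ) (2 * Real.pi),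
      ∃ C : {C : Finset (Fin n) // C.card = k}, ∀ e ∈ edgesIn C.1, InArc θ τ (X e)
      then 1 else 0 := by
    simp only [intervalStat]
    simp_rw [iSup_indicator]
  rw [intervalTest, decide_eq_true_iff, h]
  simp only [ite_eq_left_iff, zero_ne_one, imp_false, not_not]
  rw [exists_comm]
  simp only [exists_arc_iff]
  simp only [Subtype.exists, exists_prop]

theorem measurableSet_inArc {α : Type*} [MeasurableSpace α] {f g : α → ℝ} (hf : Measurable f)
    (hg : Measurable g) (τ : ℝ) : MeasurableSet {a | InArc (f a) τ (g a)} := by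
  have : {a | InArc (f a) τ (g a)} = ⋃ m : ℤ, {a | f a ≤ g a + 2 * Real.pi * m} ∩
      {a | g a + 2 * Real.pi * m ≤ f a + 2 * Real.pi * τ} := by
    ext a; simp [InArc]
  rw [this]
  exact MeasurableSet.iUnion fun m => (measurableSet_le hf (hg.add_const _)).inter
    (measurableSet_le (hg.add_const _) (hf.add_const _))

theorem measurableSet_arcFrom {n : ℕ} (C : Finset (Fin n)) (τ : ℝ) (a : Edge n) :
    MeasurableSet {X : Obs n | ∀ e ∈ edgesIn C, InArc (X a) τ (X e)} := by
  simp only [Set.ofPred_forall]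
  exact MeasurableSet.iInter fun e => MeasurableSet.iInter fun _ =>
    measurableSet_inArc (measurable_pi_apply a) (measurable_pi_apply e) τ

/-- The rejection event is an uncountable union over θ; sliding the window makes it a finite union
over opening edges. A community without edges satisfies the condition vacuously. -/
theorem measurable_intervalTest {n : ℕ} (k : ℕ) (τ : ℝ) :
    Measurable (intervalTest (n := n) k τ) := by
  refine measurable_to_bool ?_
  have : intervalTest (n := n) k τ ⁻¹' {true} = ⋃ C : Finset (Fin n), ⋃ _ : C.card = k,
      {X | ∃ θ : ℝ, ∀ e ∈ edgesIn C, InArc θ τ (X e)} := by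
    ext X; simp [intervalTest_eq_true_iff]
  rw [this]
  refine MeasurableSet.iUnion fun C => MeasurableSet.iUnion fun _ => ?_
  rcases (edgesIn C).eq_empty_or_nonempty with h | h
  · simp [h]
  · simp only [exists_arc_iff_start h, Set.ofPred_exists, Set.ofPred_and]
    exact MeasurableSet.iUnion fun a => (MeasurableSet.const _).inter (measurableSet_arcFrom C τ a)

theorem indicator_apply_congr {s t : Set ℝ} {f g : ℝ → ℝ} {x y : ℝ} (h : x ∈ s ↔ y ∈ t)
    (hfg : f x = g y) : s.indicator f x = t.indicator g y := by
  by_cases hx : x ∈ s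
  · rw [Set.indicator_of_mem hx, Set.indicator_of_mem (h.1 hx), hfg]
  · rw [Set.indicator_of_notMem hx, Set.indicator_of_notMem (mt h.2 hx)]

theorem periodic_indicator_inArc (θ τ : ℝ) (f : ℝ → ℝ) (hf : Function.Periodic f (2 * Real.pi)) :
    Function.Periodic ({x | InArc θ τ x}.indicator f) (2 * Real.pi) := by
  intro x
  have : x + 2 * Real.pi ∈ {x | InArc θ τ x} ↔ x ∈ {x | InArc θ τ x} := inArc_add_two_pi
  exact indicator_apply_congr this (hf x)

/-! ### False alarms of the interval test -/

theorem uniformAngle_inArc_le (θ : ℝ) {τ : ℝ} (h0 : 0 ≤ τ) (h1 : τ < 1) :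
    uniformAngle.real {x | InArc θ τ x} ≤ τ := by
  have hpi : (0 : ℝ) < 2 * Real.pi := by positivity
  have hms : MeasurableSet {x | InArc θ τ x} :=
    measurableSet_inArc measurable_const measurable_id τ
  have hper := periodic_indicator_inArc θ τ (fun _ => 1) (fun _ => rfl)
  have h2 := hper.intervalIntegral_add_eq 0 θ
  rw [zero_add] at h2
  rw [← integral_indicator_one hms, integral_uniformAngle]
  change 1 / (2 * Real.pi) * ∫ x in (0 : ℝ)..(2 * Real.pi),
    {x | InArc θ τ x}.indicator (fun _ => 1) x ≤ τ
  rw [h2, intervalIntegral.integral_of_le (by linarith), ← integral_Ico_eq_integral_Ioc]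
  have h3 : ∫ x in Set.Ico θ (θ + 2 * Real.pi), {x | InArc θ τ x}.indicator (fun _ => (1 : ℝ)) x
      ≤ 2 * Real.pi * τ := by
    rw [setIntegral_indicator hms]
    simp only [integral_const, MeasurableSet.univ, measureReal_restrict_apply, Set.univ_inter,
      smul_eq_mul, mul_one]
    calc volume.real (Set.Ico θ (θ + 2 * Real.pi) ∩ {x | InArc θ τ x})
        ≤ volume.real (Set.Icc θ (θ + 2 * Real.pi * τ)) := by
          refine measureReal_mono ?_ (by simp)
          rintro x ⟨⟨hx1, hx2⟩, m, hm1, hm2⟩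
          -- The period was moved to start at θ, so since τ < 1 no other translate meets the arc.
          have hm : m = 0 := by
            have ha : (m : ℝ) < 1 := by
              have : 2 * Real.pi * τ < 2 * Real.pi := by nlinarith
              by_contra! h; nlinarith
            have hb : (-1 : ℝ) < m := by by_contra! h; nlinarith
            have ha' : m < 1 := by exact_mod_cast ha
            have hb' : -1 < m := by exact_mod_cast hb
            omega
          subst hm
          simp only [Int.cast_zero, mul_zero, add_zero] at hm1 hm2
          exact ⟨hm1, hm2⟩
      _ = 2 * Real.pi * τ := by
          rw [Real.volume_real_Icc_of_le (by nlinarith)]; ring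
  rw [one_div, inv_mul_le_iff₀ hpi]
  exact h3

/-- Under the null, all edges of a set fall into the window opened by one of them with probability
at most `τ ^ (|s| - 1)`. -/
theorem nullLaw_arcFrom_le {n : ℕ} {τ : ℝ} (h0 : 0 ≤ τ) (h1 : τ < 1) (C : Finset (Fin n))
    {a : Edge n} (ha : a ∈ edgesIn C) :
    (nullLaw n).real {X | ∀ e ∈ edgesIn C, InArc (X a) τ (X e)}
      ≤ τ ^ ((edgesIn C).card - 1) := by
  classical
  -- Fubini with the opening coordinate `a` split off: once its angle is fixed, the conditions on
  -- the remaining edges are independent.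
  set p : Edge n → Prop := fun e => e = a
  have hmp := measurePreserving_piEquivPiSubtypeProd (fun _ : Edge n => uniformAngle) p
  let x0 : {e // p e} := ⟨a, rfl⟩
  set S : Set (({e // p e} → ℝ) × ({e // ¬ p e} → ℝ)) :=
    {z | ∀ e : {e // ¬ p e}, e.1 ∈ edgesIn C → InArc (z.1 x0) τ (z.2 e)}
  have hS : MeasurableSet S := by
    simp only [S, Set.ofPred_forall]
    refine MeasurableSet.iInter fun e => MeasurableSet.iInter fun _ => ?_
    exact measurableSet_inArc ((measurable_pi_apply x0).comp measurable_fst)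
      ((measurable_pi_apply e).comp measurable_snd) τ
  have hsub : {X : Obs n | ∀ e ∈ edgesIn C, InArc (X a) τ (X e)} ⊆
      (MeasurableEquiv.piEquivPiSubtypeProd (fun _ : Edge n => ℝ) p) ⁻¹' S := by
    intro X hX e he
    exact hX e.1 he
  refine (measureReal_mono hsub).trans ?_
  rw [nullLaw, hmp.measureReal_preimage hS.nullMeasurableSet]
  refine ENNReal.toReal_le_of_le_ofReal (pow_nonneg h0 _) ?_
  rw [Measure.prod_apply hS]
  have hslice : ∀ x : {e // p e} → ℝ,
      (Measure.pi fun _ : {e // ¬ p e} => uniformAngle) (Prod.mk x ⁻¹' S)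
        ≤ ENNReal.ofReal (τ ^ ((edgesIn C).card - 1)) := by
    intro x
    have : Prod.mk x ⁻¹' S = Set.univ.pi fun e : {e // ¬ p e} =>
        if e.1 ∈ edgesIn C then {y | InArc (x x0) τ y} else Set.univ := by
      ext y
      simp only [S, Set.mem_preimage, Set.mem_ofPred_eq, Set.mem_univ_pi]
      refine forall_congr' fun e => ?_
      split_ifs with h <;> simp [h]
    rw [this, Measure.pi_pi]
    calc _ ≤ ∏ e : {e // ¬ p e}, (if e.1 ∈ edgesIn C then ENNReal.ofReal τ else 1) := by
          refine Finset.prod_le_prod' fun e _ => ?_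
          split_ifs
          · rw [← ENNReal.ofReal_toReal (measure_ne_top uniformAngle _)]
            exact ENNReal.ofReal_le_ofReal (uniformAngle_inArc_le _ h0 h1)
          · simp
      _ = ∏ e ∈ Finset.univ.filter (fun e => ¬ p e),
            (if e ∈ edgesIn C then ENNReal.ofReal τ else 1) := by
          rw [Finset.prod_subtype (p := fun e => ¬ p e) (Finset.univ.filter (fun e => ¬ p e))
            (by simp)]
      _ = ENNReal.ofReal τ ^ ((edgesIn C).card - 1) := by
          rw [Finset.prod_ite, Finset.prod_const_one, mul_one, Finset.prod_const,
            ← Finset.card_erase_of_mem ha]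
          congr 2
          ext e
          simp [p]
      _ = _ := by rw [ENNReal.ofReal_pow h0]
  exact (lintegral_mono hslice).trans (by simp)

theorem pFalseAlarm_intervalTest_le {n k : ℕ} {τ : ℝ} (hk : 2 ≤ k) (hkn : k ≤ n) (h0 : 0 < τ)
    (h1 : τ < 1) : pFalseAlarm (nullLaw n) (intervalTest k τ) ≤ intervalFABound n k τ := by
  have hm : 0 < k.choose 2 := Nat.choose_pos hk
  have hsub : {X : Obs n | intervalTest k τ X = true} ⊆
      ⋃ C ∈ (Finset.univ : Finset (Fin n)).powersetCard k, ⋃ a ∈ edgesIn C,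
        {X | ∀ e ∈ edgesIn C, InArc (X a) τ (X e)} := by
    intro X hX
    obtain ⟨C, hC, h⟩ := intervalTest_eq_true_iff.1 hX
    have hne : (edgesIn C).Nonempty := by
      rw [← Finset.card_pos, card_edgesIn, hC]; exact hm
    obtain ⟨a, ha, h⟩ := (exists_arc_iff_start hne).1 h
    simp only [Set.mem_iUnion]
    exact ⟨C, Finset.mem_powersetCard.2 ⟨Finset.subset_univ _, hC⟩, a, ha, h⟩
  have hbound : pFalseAlarm (nullLaw n) (intervalTest k τ)
      ≤ n.choose k * (k.choose 2 * τ ^ (k.choose 2 - 1)) := by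
    refine (measureReal_mono hsub (measure_ne_top _ _)).trans
      ((measureReal_biUnion_finset_le _ _).trans ?_)
    calc _ ≤ ∑ C ∈ (Finset.univ : Finset (Fin n)).powersetCard k,
          (k.choose 2 * τ ^ (k.choose 2 - 1) : ℝ) := by
          refine Finset.sum_le_sum fun C hC => (measureReal_biUnion_finset_le _ _).trans ?_
          have hcard : (edgesIn C).card = k.choose 2 := by
            rw [card_edgesIn, (Finset.mem_powersetCard.1 hC).2]
          calc _ ≤ ∑ a ∈ edgesIn C, τ ^ (k.choose 2 - 1) := by
                refine Finset.sum_le_sum fun a ha => ?_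
                rw [← hcard]
                exact nullLaw_arcFrom_le h0.le h1 C ha
            _ = _ := by simp [hcard]
      _ = _ := by simp
  have hk0 : (0 : ℝ) < k := by positivity
  have hn0 : (0 : ℝ) < n := by exact_mod_cast (by omega : 0 < n)
  have hm' : (0 : ℝ) < k.choose 2 := by exact_mod_cast hm
  have hRHS : intervalFABound n k τ
      = k.choose 2 / τ * (n * Real.exp 1 / k) ^ k * τ ^ (k.choose 2) := by
    have e1 : (n * Real.exp 1 / k : ℝ) ^ k = Real.exp (k * (Real.log (n / k) + 1)) := by
      rw [Real.exp_nat_mul, Real.exp_add, Real.exp_log (by positivity)]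
      congr 1; ring
    have e2 : τ ^ (k.choose 2) = Real.exp (k * (((k : ℝ) - 1) / 2 * Real.log τ)) := by
      rw [← Real.exp_log (pow_pos h0 _), Real.log_pow, Nat.cast_choose_two]
      congr 1; ring
    rw [intervalFABound, e1, e2, mul_add, Real.exp_add, Real.exp_log (by positivity),
      Real.exp_add, mul_assoc]
  rw [hRHS]
  refine hbound.trans ?_
  -- The opening edge costs nothing, hence the exponent m - 1 and the factor m / τ in the bound.
  have hp : τ ^ (k.choose 2) = τ * τ ^ (k.choose 2 - 1) := by
    rw [← pow_succ', Nat.sub_add_cancel hm]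
  rw [hp]
  calc _ ≤ (n * Real.exp 1 / k : ℝ) ^ k * (k.choose 2 * τ ^ (k.choose 2 - 1)) := by
        gcongr
        exact choose_le_mul_exp_div_pow (by omega)
    _ = _ := by field_simp

/-! ### Misses of the interval test: the von Mises tail -/

/-- A linear upper bound for the cosine to the right of `a ∈ (0, π)`. -/
theorem cos_le_cos_sub {a u : ℝ} (h0 : 0 < a) (hau : a ≤ u) (hu : u ≤ Real.pi) :
    Real.cos u ≤ Real.cos a - Real.sin a / 2 * (u - a) := by
  -- The tangent at a fails as a majorant where the cosine is convex, so its slope is halved; u = π,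
  -- a → π shows that 1/2 cannot be improved uniformly. In half-distances from a to u and to π, the
  -- claim becomes w sin c cos c ≤ sin(2c - w) sin w.
  set w := (u - a) / 2 with hw
  set c := (Real.pi - a) / 2 with hc
  have hw0 : 0 ≤ w := by rw [hw]; linarith
  have hwc : w ≤ c := by rw [hw, hc]; linarith
  have hcpi : c < Real.pi / 2 := by rw [hc]; linarith
  have hpi := Real.pi_pos
  have hcos : Real.cos a - Real.cos u = 2 * Real.sin (2 * c - w) * Real.sin w := by
    rw [Real.cos_sub_cos, show (a + u) / 2 = Real.pi - (2 * c - w) by rw [hc, hw]; ring,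
      show (a - u) / 2 = -w by rw [hw]; ring, Real.sin_pi_sub, Real.sin_neg]
    ring
  have hsin : Real.sin a = 2 * Real.sin c * Real.cos c := by
    rw [← Real.sin_two_mul, show 2 * c = Real.pi - a by rw [hc]; ring, Real.sin_pi_sub]
  have hcc : 0 ≤ Real.cos c := Real.cos_nonneg_of_mem_Icc ⟨by linarith, hcpi.le⟩
  have hsc : 0 ≤ Real.sin c := Real.sin_nonneg_of_nonneg_of_le_pi (by linarith) (by linarith)
  have hsw : 0 ≤ Real.sin w := Real.sin_nonneg_of_nonneg_of_le_pi hw0 (by linarith)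
  have hcw : Real.cos c ≤ Real.cos w := Real.cos_le_cos_of_nonneg_of_le_pi hw0 (by linarith) hwc
  have htan : w * Real.cos w ≤ Real.sin w := by
    have hcw0 : 0 < Real.cos w := Real.cos_pos_of_mem_Ioo ⟨by linarith, by linarith⟩
    have := Real.le_tan hw0 (by linarith)
    rwa [Real.tan_eq_sin_div_cos, le_div_iff₀ hcw0] at this
  suffices h : w * (Real.sin c * Real.cos c) ≤ Real.sin (2 * c - w) * Real.sin w by
    have e : Real.sin a / 2 * (u - a) = 2 * (w * (Real.sin c * Real.cos c)) := by
      rw [hsin, hw]; ring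
    linarith
  -- If 3c - w ≤ π, then sin c ≤ sin(2c - w), and w cos c ≤ sin w handles the other factor.
  -- Otherwise 2c - w is at least π/2, where the sine decreases, so sin 2c ≤ sin(2c - w), and w/2 ≤
  -- sin w suffices.
  rcases le_total (3 * c - w) Real.pi with h3 | h3
  · have h1 : Real.sin c ≤ Real.sin (2 * c - w) := by
      have h4 : 0 ≤ Real.cos ((3 * c - w) / 2) :=
        Real.cos_nonneg_of_mem_Icc ⟨by linarith, by linarith⟩
      have h5 : 0 ≤ Real.sin ((c - w) / 2) :=
        Real.sin_nonneg_of_nonneg_of_le_pi (by linarith) (by linarith)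
      have := Real.sin_sub_sin (2 * c - w) c
      rw [show (2 * c - w - c) / 2 = (c - w) / 2 by ring,
        show (2 * c - w + c) / 2 = (3 * c - w) / 2 by ring] at this
      nlinarith [mul_nonneg h5 h4]
    calc w * (Real.sin c * Real.cos c) = Real.sin c * (w * Real.cos c) := by ring
      _ ≤ Real.sin (2 * c - w) * Real.sin w := by
        refine mul_le_mul h1 ?_ (by positivity) (hsc.trans h1)
        exact (mul_le_mul_of_nonneg_left hcw hw0).trans htan
  · have h1 : 2 * Real.sin c * Real.cos c ≤ Real.sin (2 * c - w) := by
      rw [← Real.sin_two_mul, ← Real.cos_sub_pi_div_two, ← Real.cos_sub_pi_div_two (2 * c - w)]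
      exact Real.cos_le_cos_of_nonneg_of_le_pi (by linarith) (by linarith) (by linarith)
    have h2 : w / 2 ≤ Real.sin w := by
      have := Real.mul_le_sin hw0 (by linarith)
      refine le_trans ?_ this
      rw [div_eq_inv_mul]
      refine mul_le_mul_of_nonneg_right ?_ hw0
      rw [le_div_iff₀ hpi]
      linarith [Real.pi_le_four]
    calc w * (Real.sin c * Real.cos c) = 2 * Real.sin c * Real.cos c * (w / 2) := by ring
      _ ≤ _ := mul_le_mul h1 h2 (by positivity) (le_trans (by positivity) h1)

/-- The linear majorant leaves an exponential of rate κ sin(a)/2, which is integrated exactly; the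
contribution of the end-point π is discarded. -/
theorem integral_exp_cos_tail_le {κ a : ℝ} (hκ : 0 < κ) (h0 : 0 < a) (ha : a < Real.pi) :
    ∫ u in a..Real.pi, Real.exp (κ * Real.cos u)
      ≤ 2 * Real.exp (κ * Real.cos a) / (κ * Real.sin a) := by
  have hs : 0 < Real.sin a := Real.sin_pos_of_pos_of_lt_pi h0 ha
  set c := κ * Real.sin a / 2 with hc
  have hc0 : 0 < c := by positivity
  have hderiv : ∀ u : ℝ, HasDerivAt
      (fun u => -(Real.exp (κ * Real.cos a - c * (u - a)) / c))
      (Real.exp (κ * Real.cos a - c * (u - a))) u := by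
    intro u
    have h1 : HasDerivAt (fun u => κ * Real.cos a - c * (u - a)) (-(c * 1)) u :=
      (((hasDerivAt_id u).sub_const a).const_mul c).const_sub _
    refine (h1.exp.div_const c).neg.congr_deriv ?_
    field_simp
  calc ∫ u in a..Real.pi, Real.exp (κ * Real.cos u)
      ≤ ∫ u in a..Real.pi, Real.exp (κ * Real.cos a - c * (u - a)) := by
        refine intervalIntegral.integral_mono_on ha.le
          (Continuous.intervalIntegrable (by fun_prop) _ _)
          (Continuous.intervalIntegrable (by fun_prop) _ _) fun u hu => ?_
        rw [Real.exp_le_exp]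
        have := mul_le_mul_of_nonneg_left (cos_le_cos_sub h0 hu.1 hu.2) hκ.le
        rw [hc]
        linarith
    _ = Real.exp (κ * Real.cos a) / c - Real.exp (κ * Real.cos a - c * (Real.pi - a)) / c := by
        rw [intervalIntegral.integral_eq_sub_of_hasDerivAt (fun u _ => hderiv u)
          (Continuous.intervalIntegrable (by fun_prop) _ _)]
        simp; ring
    _ ≤ Real.exp (κ * Real.cos a) / c := by
        have : 0 ≤ Real.exp (κ * Real.cos a - c * (Real.pi - a)) / c := by positivity
        linarith
    _ = _ := by rw [hc]; field_simp

/-- The von Mises mass outside the arc of half-width `π τ` around the location. -/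
theorem vonMises_not_inArc_le {κ τ : ℝ} (hκ : 0 < κ) (h0 : 0 < τ) (h1 : τ < 1) (θ : ℝ) :
    (vonMises θ κ).real {x | ¬ InArc (θ - Real.pi * τ) τ x}
      ≤ 2 * Real.exp (κ * Real.cos (Real.pi * τ))
        / (Real.pi * besselI0 κ * κ * Real.sin (Real.pi * τ)) := by
  have hpi := Real.pi_pos
  have hI := besselI0_pos κ
  set a := Real.pi * τ with ha
  have ha0 : 0 < a := by positivity
  have hap : a < Real.pi := by rw [ha]; nlinarith
  have hs : 0 < Real.sin a := Real.sin_pos_of_pos_of_lt_pi ha0 hap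
  have hms : MeasurableSet {x | ¬ InArc (θ - a) τ x} :=
    (measurableSet_inArc measurable_const measurable_id τ).compl
  set f : ℝ → ℝ := {u | ¬ InArc (-a) τ u}.indicator 1 with hf
  have hms' : MeasurableSet {u | ¬ InArc (-a) τ u} :=
    (measurableSet_inArc measurable_const measurable_id τ).compl
  have hfper : Function.Periodic f (2 * Real.pi) := by
    intro u
    have : u + 2 * Real.pi ∈ {x | ¬ InArc (-a) τ x} ↔ u ∈ {x | ¬ InArc (-a) τ x} :=
      inArc_add_two_pi.not
    exact indicator_apply_congr this rfl
  have hshift : {x | ¬ InArc (θ - a) τ x}.indicator (1 : ℝ → ℝ) = fun x => f (x - θ) := by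
    ext x
    have : x ∈ {x | ¬ InArc (θ - a) τ x} ↔ x - θ ∈ {u | ¬ InArc (-a) τ u} := by
      refine not_congr (exists_congr fun m => ?_)
      constructor <;> rintro ⟨h1, h2⟩ <;> constructor <;> linarith
    exact indicator_apply_congr this rfl
  have hper : Function.Periodic (fun u => Real.exp (κ * Real.cos u) * f u) (2 * Real.pi) := by
    intro u; simp [hfper u]
  have hin : ∀ u ∈ Set.Icc (-a) a, f u = 0 := by
    intro u hu
    have : InArc (-a) τ u := ⟨0, by
      simp only [Int.cast_zero, mul_zero, add_zero]
      exact ⟨hu.1, hu.2.trans (by rw [ha]; linarith)⟩⟩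
    simp [hf, this]
  have hexp_nonneg : ∀ u, Real.exp (κ * Real.cos u) * f u ≤ Real.exp (κ * Real.cos u) := by
    intro u
    refine mul_le_of_le_one_right (Real.exp_pos _).le ?_
    exact Set.indicator_le_self' (by simp) u
  have hint : ∀ p q : ℝ, IntervalIntegrable (fun u => Real.exp (κ * Real.cos u) * f u)
      volume p q := by
    intro p q
    refine (Continuous.intervalIntegrable
      (by fun_prop : Continuous fun u => Real.exp (κ * Real.cos u)) p q).mono_fun ?_ ?_
    · exact ((by fun_prop : Continuous fun u =>
        Real.exp (κ * Real.cos u)).measurable.mul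
          (measurable_one.indicator hms')).aestronglyMeasurable
    · refine Eventually.of_forall fun u => ?_
      have : 0 ≤ f u := Set.indicator_nonneg (by simp) u
      dsimp only
      rw [Real.norm_of_nonneg (by positivity), Real.norm_of_nonneg (by positivity)]
      exact hexp_nonneg u
  have hci : ∀ p q : ℝ, IntervalIntegrable (fun u => Real.exp (κ * Real.cos u)) volume p q :=
    fun p q => Continuous.intervalIntegrable (by fun_prop) p q
  have hrefl : ∫ u in Real.pi..(2 * Real.pi - a), Real.exp (κ * Real.cos u)
      = ∫ u in a..Real.pi, Real.exp (κ * Real.cos u) := by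
    have := intervalIntegral.integral_comp_sub_left (a := a) (b := Real.pi)
      (fun u => Real.exp (κ * Real.cos u)) (2 * Real.pi)
    rw [show 2 * Real.pi - Real.pi = Real.pi by ring] at this
    rw [← this]
    simp [Real.cos_two_pi_sub]
  -- Over the period starting at -a, the integrand vanishes on [-a, a], and the rest is symmetric
  -- about π, giving two equal tails.
  have key : ∫ u in (0 : ℝ)..(2 * Real.pi), Real.exp (κ * Real.cos u) * f u
      ≤ 2 * (2 * Real.exp (κ * Real.cos a) / (κ * Real.sin a)) := by
    have h2 := hper.intervalIntegral_add_eq (-a) 0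
    rw [zero_add] at h2
    rw [← h2, ← intervalIntegral.integral_add_adjacent_intervals (hint (-a) a) (hint a _)]
    have hz : ∫ u in (-a)..a, Real.exp (κ * Real.cos u) * f u = 0 := by
      rw [intervalIntegral.integral_congr (g := fun _ => 0)]
      · simp
      · intro u hu
        rw [Set.uIcc_of_le (by linarith)] at hu
        simp [hin u hu]
    rw [hz, zero_add, show -a + 2 * Real.pi = 2 * Real.pi - a by ring]
    calc _ ≤ ∫ u in a..(2 * Real.pi - a), Real.exp (κ * Real.cos u) :=
          intervalIntegral.integral_mono_on (by linarith) (hint _ _) (hci _ _)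
            fun u _ => hexp_nonneg u
      _ = 2 * ∫ u in a..Real.pi, Real.exp (κ * Real.cos u) := by
          rw [← intervalIntegral.integral_add_adjacent_intervals (hci a Real.pi) (hci Real.pi _),
            hrefl, two_mul]
      _ ≤ _ := by
          have := integral_exp_cos_tail_le hκ ha0 hap
          linarith
  rw [← integral_indicator_one hms, hshift, integral_vonMises_centred θ κ hfper]
  calc _ ≤ 1 / (2 * Real.pi * besselI0 κ)
        * (2 * (2 * Real.exp (κ * Real.cos a) / (κ * Real.sin a))) := by gcongr
    _ = _ := by field_simp

/-- The window centred at the planted phase fails only if some community edge lies outside it, so a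
union bound over the edges applies. -/
theorem pMiss_intervalTest_le {n k : ℕ} {κ τ : ℝ} (hkn : k ≤ n) (hκ : 0 < κ)
    (h0 : 0 < τ) (h1 : τ < 1) :
    pMiss (plantedLaw n k κ) (intervalTest k τ) ≤ intervalMissBound k κ τ := by
  have hpi := Real.pi_pos
  have hs : 0 < Real.sin (Real.pi * τ) :=
    Real.sin_pos_of_pos_of_lt_pi (by positivity) (by nlinarith)
  have hbound : intervalMissBound k κ τ = k.choose 2 * (2 * Real.exp (κ * Real.cos (Real.pi * τ))
        / (Real.pi * besselI0 κ * κ * Real.sin (Real.pi * τ))) := by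
    have hI := besselI0_pos κ
    rw [intervalMissBound, abs_of_pos hs,
      show (Real.cos (Real.pi * τ) - 1) * κ = κ * Real.cos (Real.pi * τ) + -κ by ring,
      Real.exp_add]
    field_simp
  refine plantedLaw_real_le hkn (measurable_intervalTest k τ (MeasurableSet.singleton false))
    fun C hC θ => ?_
  have hsub : {X : Obs n | intervalTest k τ X = false} ⊆
      ⋃ e ∈ edgesIn C, {X | X e ∈ {x | ¬ InArc (θ - Real.pi * τ) τ x}} := by
    intro X hX
    by_contra hcon
    simp only [Set.mem_iUnion, not_exists] at hcon
    have : intervalTest k τ X = true :=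
      intervalTest_eq_true_iff.2 ⟨C, hC, _, fun e he => not_not.1 (hcon e he)⟩
    have hX' : intervalTest k τ X = false := hX
    simp [this] at hX'
  rw [hbound]
  refine (measureReal_mono hsub (measure_ne_top _ _)).trans
    ((measureReal_biUnion_finset_le _ _).trans ?_)
  calc _ ≤ ∑ e ∈ edgesIn C, 2 * Real.exp (κ * Real.cos (Real.pi * τ))
        / (Real.pi * besselI0 κ * κ * Real.sin (Real.pi * τ)) := by
        refine Finset.sum_le_sum fun e he => ?_
        have hms : MeasurableSet {x | ¬ InArc (θ - Real.pi * τ) τ x} :=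
          (measurableSet_inArc measurable_const measurable_id τ).compl
        rw [plantedLawGiven_real_eval C κ θ he hms]
        exact vonMises_not_inArc_le hκ h0 h1 θ
    _ = _ := by simp [card_edgesIn, hC]

/-! ### Bessel function estimates and sub-Gaussian bounds -/

theorem periodic_comp_cos (g : ℝ → ℝ) : Function.Periodic (fun u => g (Real.cos u)) (2 * Real.pi) :=
  fun u => by simp

theorem integral_comp_neg_cos (g : ℝ → ℝ) :
    ∫ u in (0 : ℝ)..(2 * Real.pi), g (-Real.cos u)
      = ∫ u in (0 : ℝ)..(2 * Real.pi), g (Real.cos u) := by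
  rw [← integral_period_shift (periodic_comp_cos g) Real.pi]
  simp

theorem integral_comp_sin (g : ℝ → ℝ) :
    ∫ u in (0 : ℝ)..(2 * Real.pi), g (Real.sin u)
      = ∫ u in (0 : ℝ)..(2 * Real.pi), g (Real.cos u) := by
  rw [← integral_period_shift (periodic_comp_cos g) (-(Real.pi / 2))]
  simp [← sub_eq_add_neg, Real.cos_sub_pi_div_two]

/-- The half-sum is cosh((x+y)/2) cosh((x-y)/2); apply cosh z ≤ exp(z²/2) to each factor. -/
theorem cosh_add_cosh_le (x y : ℝ) :
    (Real.cosh x + Real.cosh y) / 2 ≤ Real.exp ((x ^ 2 + y ^ 2) / 4) := by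
  have h : (Real.cosh x + Real.cosh y) / 2 = Real.cosh ((x + y) / 2) * Real.cosh ((x - y) / 2) := by
    have hx : x = (x + y) / 2 + (x - y) / 2 := by ring
    have hy : y = (x + y) / 2 - (x - y) / 2 := by ring
    conv_lhs => rw [hx, hy, Real.cosh_add, Real.cosh_sub]
    ring_nf
  rw [h]
  calc _ ≤ Real.exp (((x + y) / 2) ^ 2 / 2) * Real.exp (((x - y) / 2) ^ 2 / 2) :=
        mul_le_mul (Real.cosh_le_exp_half_sq _) (Real.cosh_le_exp_half_sq _)
          (Real.cosh_pos _).le (Real.exp_pos _).le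
    _ = _ := by rw [← Real.exp_add]; congr 1; ring

/-- Averaging over quarter-turns replaces exp(t cos u) by (cosh(t cos u) + cosh(t sin u))/2, which
is at most exp(t²/4) pointwise. Using only the half-turn would give exp(t²/2) and lose a factor 2 in
the coherence bound. -/
theorem besselI0_le (t : ℝ) : besselI0 t ≤ Real.exp (t ^ 2 / 4) := by
  have hpi : (0 : ℝ) < 2 * Real.pi := by positivity
  have hi : ∀ f : ℝ → ℝ, Continuous f → IntervalIntegrable f volume 0 (2 * Real.pi) :=
    fun f hf => hf.intervalIntegrable _ _
  have h1 : ∫ u in (0 : ℝ)..(2 * Real.pi), Real.cosh (t * Real.cos u)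
      = ∫ u in (0 : ℝ)..(2 * Real.pi), Real.exp (t * Real.cos u) := by
    have := integral_comp_neg_cos fun x => Real.exp (t * x)
    simp only [Real.cosh_eq]
    rw [intervalIntegral.integral_div, intervalIntegral.integral_add (hi _ (by fun_prop))
      (hi _ (by fun_prop))]
    simp only [mul_neg] at this
    rw [this]; ring
  have h2 := integral_comp_sin fun x => Real.cosh (t * x)
  have h3 : ∫ u in (0 : ℝ)..(2 * Real.pi), Real.exp (t * Real.cos u)
      = ∫ u in (0 : ℝ)..(2 * Real.pi),
        (Real.cosh (t * Real.cos u) + Real.cosh (t * Real.sin u)) / 2 := by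
    rw [intervalIntegral.integral_div, intervalIntegral.integral_add (hi _ (by fun_prop))
      (hi _ (by fun_prop)), h2, h1]
    ring
  have h4 : ∫ u in (0 : ℝ)..(2 * Real.pi),
        (Real.cosh (t * Real.cos u) + Real.cosh (t * Real.sin u)) / 2
      ≤ ∫ _ in (0 : ℝ)..(2 * Real.pi), Real.exp (t ^ 2 / 4) := by
    refine intervalIntegral.integral_mono_on hpi.le (hi _ (by fun_prop)) (hi _ (by fun_prop))
      fun u _ => (cosh_add_cosh_le _ _).trans_eq ?_
    rw [mul_pow, mul_pow, ← mul_add, Real.cos_sq_add_sin_sq, mul_one]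
  rw [besselI0, h3, one_div, inv_mul_le_iff₀ hpi]
  simpa using h4

/-- Pair u with u + π: the sum of the two integrands is cos u · (exp(κ cos u) - exp(-κ cos u)) ≥ 0.
-/
theorem besselI1_nonneg {κ : ℝ} (hκ : 0 ≤ κ) : 0 ≤ besselI1 κ := by
  have hpi : (0 : ℝ) < 2 * Real.pi := by positivity
  have hi : ∀ f : ℝ → ℝ, Continuous f → IntervalIntegrable f volume 0 (2 * Real.pi) :=
    fun f hf => hf.intervalIntegrable _ _
  have h := integral_comp_neg_cos fun x => x * Real.exp (κ * x)
  have h2 : 0 ≤ ∫ u in (0 : ℝ)..(2 * Real.pi), (Real.cos u * Real.exp (κ * Real.cos u)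
      + -Real.cos u * Real.exp (κ * -Real.cos u)) := by
    refine intervalIntegral.integral_nonneg hpi.le fun u _ => ?_
    rcases le_total 0 (Real.cos u) with hc | hc
    · have : Real.exp (κ * -Real.cos u) ≤ Real.exp (κ * Real.cos u) := by
        rw [Real.exp_le_exp]; nlinarith
      nlinarith
    · have : Real.exp (κ * Real.cos u) ≤ Real.exp (κ * -Real.cos u) := by
        rw [Real.exp_le_exp]; nlinarith
      nlinarith
  rw [intervalIntegral.integral_add (hi _ (by fun_prop)) (hi _ (by fun_prop)), h] at h2
  rw [besselI1]
  exact mul_nonneg (by positivity) (by linarith)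

theorem ratioA_nonneg {κ : ℝ} (hκ : 0 ≤ κ) : 0 ≤ ratioA κ :=
  div_nonneg (besselI1_nonneg hκ) (besselI0_pos κ).le

theorem integral_cos_vonMises (θ κ : ℝ) :
    ∫ x, Real.cos (x - θ) ∂(vonMises θ κ) = ratioA κ := by
  have := besselI0_pos κ
  rw [integral_vonMises_centred θ κ (f := Real.cos) Real.cos_periodic, ratioA, besselI1]
  simp_rw [mul_comm (Real.cos _) (Real.exp _)]
  field_simp

theorem hasSubgaussianMGF_cos_uniform (φ : ℝ) :
    ProbabilityTheory.HasSubgaussianMGF (fun x => Real.cos (x - φ)) (1 / 2) uniformAngle where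
  integrable_exp_mul t := by
    refine Integrable.of_bound (by fun_prop) (Real.exp |t|) (Eventually.of_forall fun x => ?_)
    rw [Real.norm_of_nonneg (Real.exp_pos _).le, Real.exp_le_exp]
    calc _ ≤ |t * Real.cos (x - φ)| := le_abs_self _
      _ = |t| * |Real.cos (x - φ)| := abs_mul _ _
      _ ≤ |t| * 1 := by gcongr; exact Real.abs_cos_le_one _
      _ = _ := mul_one _
  mgf_le t := by
    have : ProbabilityTheory.mgf (fun x => Real.cos (x - φ)) uniformAngle t = besselI0 t := by
      rw [ProbabilityTheory.mgf, integral_uniformAngle, besselI0,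
        ← integral_period_shift (periodic_comp_cos fun x => Real.exp (t * x)) (-φ)]
      simp [sub_eq_add_neg]
    rw [this]
    refine (besselI0_le t).trans_eq ?_
    congr 1
    push_cast
    ring

/-- Hoeffding's lemma on [-1, 1] gives the proxy 1. The sign is reversed because a miss is a
downward deviation. -/
theorem hasSubgaussianMGF_cos_vonMises (θ κ : ℝ) :
    ProbabilityTheory.HasSubgaussianMGF (fun x => ratioA κ - Real.cos (x - θ)) 1
      (vonMises θ κ) := by
  have h := (ProbabilityTheory.hasSubgaussianMGF_of_mem_Icc (μ := vonMises θ κ)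
    (X := fun x => Real.cos (x - θ)) (a := -1) (b := 1) (by fun_prop)
    (Eventually.of_forall fun x => ⟨Real.neg_one_le_cos _, Real.cos_le_one _⟩)).neg
  rw [integral_cos_vonMises] at h
  convert h using 1
  · ext x; simp
  · ext
    push_cast
    norm_num

/-- Hoeffding's inequality for functions of the separate coordinates of a product measure. -/
theorem measure_pi_sum_ge_le {ι : Type*} [Fintype ι] {μ : ι → Measure ℝ}
    [∀ i, IsProbabilityMeasure (μ i)] {f : ℝ → ℝ} (hf : Measurable f) {c : NNReal} {s : Finset ι}
    (h : ∀ i ∈ s, ProbabilityTheory.HasSubgaussianMGF f c (μ i)) {t : ℝ} (ht : 0 ≤ t) :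
    (Measure.pi μ).real {x | t ≤ ∑ i ∈ s, f (x i)} ≤ Real.exp (-t ^ 2 / (2 * (s.card * c))) := by
  have hind : ProbabilityTheory.iIndepFun (fun i (x : ι → ℝ) => f (x i)) (Measure.pi μ) :=
    ProbabilityTheory.iIndepFun_pi fun i => hf.aemeasurable
  have hs : ∀ i ∈ s, ProbabilityTheory.HasSubgaussianMGF (fun x : ι → ℝ => f (x i)) c
      (Measure.pi μ) := by
    intro i hi
    have hmp := measurePreserving_eval μ i
    refine ⟨fun u => ?_, fun u => ?_⟩
    · exact integrable_comp_eval (μ := μ) (f := fun x : ℝ => Real.exp (u * f x))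
        ((h i hi).integrable_exp_mul u)
    · have := (h i hi).mgf_le u
      rw [ProbabilityTheory.mgf, ← hmp.map_eq,
        integral_map hmp.aemeasurable (by fun_prop)] at this
      exact this
  have := ProbabilityTheory.HasSubgaussianMGF.measure_sum_ge_le_of_iIndepFun hind hs ht
  simpa using this

/-! ### The coherence test -/

theorem measurable_coherenceStat {n : ℕ} (k : ℕ) : Measurable (coherenceStat (n := n) k) := by
  refine Measurable.iSup fun C => ?_
  refine Measurable.norm (Finset.measurable_sum _ fun e _ => ?_)
  fun_prop

theorem measurable_coherenceTest {n : ℕ} (k : ℕ) (β : ℝ) :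
    Measurable (coherenceTest (n := n) k β) := by
  refine measurable_to_bool ?_
  have : coherenceTest (n := n) k β ⁻¹' {true} = {X | β ≤ coherenceStat k X} := by
    ext X; simp [coherenceTest]
  rw [this]
  exact measurableSet_le measurable_const (measurable_coherenceStat k)

theorem coherenceTest_eq_true_iff {n k : ℕ} (hk : k ≤ n) {β : ℝ} {X : Obs n} :
    coherenceTest k β X = true ↔ ∃ C : Finset (Fin n), C.card = k ∧
      β ≤ ‖∑ e ∈ edgesIn C, Complex.exp (Complex.I * (X e : ℂ))‖ := by
  have hne : Nonempty {C : Finset (Fin n) // C.card = k} := by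
    obtain ⟨C, _, hC⟩ := Finset.exists_subset_card_eq
      (show k ≤ (Finset.univ : Finset (Fin n)).card by simpa using hk)
    exact ⟨⟨C, hC⟩⟩
  rw [coherenceTest, decide_eq_true_iff, coherenceStat]
  constructor
  · intro h
    obtain ⟨C, hC⟩ := exists_eq_ciSup_of_finite
      (f := fun C : {C : Finset (Fin n) // C.card = k} =>
        ‖∑ e ∈ edgesIn C.1, Complex.exp (Complex.I * (X e : ℂ))‖)
    exact ⟨C.1, C.2, h.trans_eq hC.symm⟩
  · rintro ⟨C, hC, h⟩
    exact le_ciSup_of_le (Set.finite_range _).bddAbove ⟨C, hC⟩ h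

theorem re_sum_exp_mul {ι : Type*} (s : Finset ι) (x : ι → ℝ) (φ : ℝ) :
    ((∑ e ∈ s, Complex.exp (Complex.I * (x e : ℂ))) * Complex.exp (-(Complex.I * φ))).re
      = ∑ e ∈ s, Real.cos (x e - φ) := by
  rw [Finset.sum_mul, Complex.re_sum]
  refine Finset.sum_congr rfl fun e _ => ?_
  rw [← Complex.exp_add, show Complex.I * (x e : ℂ) + -(Complex.I * φ)
    = ((x e - φ : ℝ) : ℂ) * Complex.I by push_cast; ring, Complex.exp_ofReal_mul_I_re]

theorem sum_cos_le_norm {ι : Type*} (s : Finset ι) (x : ι → ℝ) (φ : ℝ) :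
    ∑ e ∈ s, Real.cos (x e - φ) ≤ ‖∑ e ∈ s, Complex.exp (Complex.I * (x e : ℂ))‖ := by
  rw [← re_sum_exp_mul]
  refine (Complex.re_le_norm _).trans ?_
  rw [norm_mul, show -(Complex.I * (φ : ℂ)) = ((-φ : ℝ) : ℂ) * Complex.I by push_cast; ring,
    Complex.norm_exp_ofReal_mul_I, mul_one]

/-- One of `B` equispaced directions captures a fraction `cos (π / B)` of the modulus. -/
theorem exists_direction (z : ℂ) {B : ℕ} (hB : 1 ≤ B) :
    ∃ b ∈ Finset.range B, ‖z‖ * Real.cos (Real.pi / B)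
      ≤ (z * Complex.exp (-(Complex.I * ((2 * Real.pi * b / B : ℝ) : ℂ)))).re := by
  have hpi := Real.pi_pos
  have hB0 : (0 : ℝ) < B := by exact_mod_cast hB
  have hBz : (0 : ℤ) < B := by exact_mod_cast hB
  -- The argument in units of 2π/B: rounding it costs an angle of at most π/B. Reduction modulo B
  -- brings the index into range and changes the angle by full turns only.
  set y := Complex.arg z * B / (2 * Real.pi) with hy
  set r : ℤ := round y with hr
  have hre : ∀ φ : ℝ, (z * Complex.exp (-(Complex.I * (φ : ℂ)))).re
      = ‖z‖ * Real.cos (Complex.arg z - φ) := by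
    intro φ
    conv_lhs => rw [← Complex.norm_mul_exp_arg_mul_I z]
    rw [mul_assoc, ← Complex.exp_add,
      show (Complex.arg z : ℂ) * Complex.I + -(Complex.I * φ)
        = ((Complex.arg z - φ : ℝ) : ℂ) * Complex.I by push_cast; ring,
      Complex.re_ofReal_mul, Complex.exp_ofReal_mul_I_re]
  refine ⟨(r % B).toNat, ?_, ?_⟩
  · rw [Finset.mem_range]
    have h1 := Int.emod_nonneg r hBz.ne'
    have h2 := Int.emod_lt_of_pos r hBz
    omega
  rw [hre]
  refine mul_le_mul_of_nonneg_left ?_ (norm_nonneg z)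
  have hcast : (((r % B).toNat : ℕ) : ℝ) = (r : ℝ) - B * ((r / B : ℤ) : ℝ) := by
    have h1 : (((r % B).toNat : ℕ) : ℤ) = r - B * (r / B) := by
      rw [Int.toNat_of_nonneg (Int.emod_nonneg r hBz.ne'), Int.emod_def]
    exact_mod_cast h1
  have heq : Complex.arg z - 2 * Real.pi * ((r % B).toNat : ℕ) / B
      = 2 * Real.pi / B * (y - r) + ((r / B : ℤ) : ℝ) * (2 * Real.pi) := by
    rw [hcast, hy]; field_simp; ring
  rw [heq, Real.cos_add_int_mul_two_pi, ← Real.cos_abs (2 * Real.pi / B * (y - r))]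
  have habs : |2 * Real.pi / B * (y - r)| ≤ Real.pi / B := by
    rw [abs_mul, abs_of_pos (by positivity : 0 < 2 * Real.pi / (B : ℝ))]
    calc _ ≤ 2 * Real.pi / B * (1 / 2) := by
          gcongr; exact abs_sub_round y
      _ = _ := by ring
  refine Real.cos_le_cos_of_nonneg_of_le_pi (abs_nonneg _) ?_ habs
  rw [div_le_iff₀ hB0]
  have : (1 : ℝ) ≤ B := by exact_mod_cast hB
  nlinarith

theorem pFalseAlarm_coherenceTest_le {n k : ℕ} {κ : ℝ} {B : ℕ} {ε : ℝ} (hk : 1 ≤ k) (hkn : k ≤ n)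
    (hκ : 0 < κ) (hB : 3 ≤ B) (hε1 : ε < 1) :
    pFalseAlarm (nullLaw n) (coherenceTest k (coherenceThreshold k κ ε))
      ≤ coherenceFABound n k κ B ε := by
  have hpi := Real.pi_pos
  have hA := ratioA_nonneg hκ.le
  have hBr : (3 : ℝ) ≤ B := by exact_mod_cast hB
  have hcos : 0 ≤ Real.cos (Real.pi / B) := by
    refine Real.cos_nonneg_of_mem_Icc ⟨?_, ?_⟩
    · have : 0 ≤ Real.pi / B := by positivity
      linarith
    · gcongr; linarith
  set β := coherenceThreshold k κ ε with hβ
  have hβ0 : 0 ≤ β := by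
    rw [hβ, coherenceThreshold]
    have : 0 ≤ 1 - ε / 4 := by linarith
    positivity
  set t := β * Real.cos (Real.pi / B) with ht
  have ht0 : 0 ≤ t := mul_nonneg hβ0 hcos
  have hsub : {X : Obs n | coherenceTest k β X = true} ⊆
      ⋃ C ∈ (Finset.univ : Finset (Fin n)).powersetCard k, ⋃ b ∈ Finset.range B,
        {X | t ≤ ∑ e ∈ edgesIn C, Real.cos (X e - 2 * Real.pi * b / B)} := by
    intro X hX
    obtain ⟨C, hC, h⟩ := (coherenceTest_eq_true_iff hkn).1 hX
    obtain ⟨b, hb, hdir⟩ := exists_direction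
      (∑ e ∈ edgesIn C, Complex.exp (Complex.I * (X e : ℂ))) (by omega : 1 ≤ B)
    rw [re_sum_exp_mul] at hdir
    simp only [Set.mem_iUnion]
    exact ⟨C, Finset.mem_powersetCard.2 ⟨Finset.subset_univ _, hC⟩, b, hb,
      (mul_le_mul_of_nonneg_right h hcos).trans hdir⟩
  have hexp : -t ^ 2 / (2 * ((k.choose 2 : ℝ) * ((1 / 2 : NNReal) : ℝ)))
      = -(k * ((1 - ε / 4) ^ 2 * ((k : ℝ) - 1) * ratioA κ ^ 2 * Real.cos (Real.pi / B) ^ 2 / 2)) := by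
    have hm : (k.choose 2 : ℝ) = k * (k - 1) / 2 := Nat.cast_choose_two ℝ k
    -- For k = 1 there are no edges, and the left side is 0 / 0 = 0, matching the right.
    rcases eq_or_ne ((k : ℝ) - 1) 0 with h | h
    · rw [ht, hβ, coherenceThreshold, hm, h]; simp
    · have hk0 : (k : ℝ) ≠ 0 := by positivity
      rw [ht, hβ, coherenceThreshold, hm]
      push_cast
      field_simp
  have hsingle : ∀ C ∈ (Finset.univ : Finset (Fin n)).powersetCard k, ∀ b ∈ Finset.range B,
      (nullLaw n).real {X | t ≤ ∑ e ∈ edgesIn C, Real.cos (X e - 2 * Real.pi * b / B)}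
      ≤ Real.exp (-(k * ((1 - ε / 4) ^ 2 * ((k : ℝ) - 1) * ratioA κ ^ 2
          * Real.cos (Real.pi / B) ^ 2 / 2))) := by
    intro C hC b _
    have := measure_pi_sum_ge_le (μ := fun _ : Edge n => uniformAngle)
      (f := fun x => Real.cos (x - 2 * Real.pi * b / B)) (by fun_prop) (s := edgesIn C)
      (fun _ _ => hasSubgaussianMGF_cos_uniform _) ht0
    rw [card_edgesIn, (Finset.mem_powersetCard.1 hC).2, hexp] at this
    exact this
  refine (measureReal_mono hsub (measure_ne_top _ _)).trans
    ((measureReal_biUnion_finset_le _ _).trans ?_)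
  calc _ ≤ ∑ C ∈ (Finset.univ : Finset (Fin n)).powersetCard k, ∑ b ∈ Finset.range B,
        Real.exp (-(k * ((1 - ε / 4) ^ 2 * ((k : ℝ) - 1) * ratioA κ ^ 2
          * Real.cos (Real.pi / B) ^ 2 / 2))) :=
        Finset.sum_le_sum fun C hC => (measureReal_biUnion_finset_le _ _).trans
          (Finset.sum_le_sum fun b hb => hsingle C hC b hb)
    _ = n.choose k * (B * Real.exp (-(k * ((1 - ε / 4) ^ 2 * ((k : ℝ) - 1) * ratioA κ ^ 2
          * Real.cos (Real.pi / B) ^ 2 / 2)))) := by simp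
    _ ≤ (n * Real.exp 1 / k) ^ k * (B * Real.exp (-(k * ((1 - ε / 4) ^ 2 * ((k : ℝ) - 1)
          * ratioA κ ^ 2 * Real.cos (Real.pi / B) ^ 2 / 2)))) := by
        gcongr
        exact choose_le_mul_exp_div_pow hk
    _ = coherenceFABound n k κ B ε := by
        have hk0 : (0 : ℝ) < k := by exact_mod_cast hk
        have hn0 : (0 : ℝ) < n := by exact_mod_cast (by omega : 0 < n)
        rw [coherenceFABound, mul_sub (k : ℝ), sub_eq_add_neg (_ * _), Real.exp_add,
          Real.exp_nat_mul,
          Real.exp_log (by positivity)]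
        ring

theorem pMiss_coherenceTest_le {n k : ℕ} {κ ε : ℝ} (hkn : k ≤ n) (hκ : 0 < κ) (hε0 : 0 < ε) :
    pMiss (plantedLaw n k κ) (coherenceTest k (coherenceThreshold k κ ε))
      ≤ coherenceMissBound k κ ε := by
  have hA := ratioA_nonneg hκ.le
  set β := coherenceThreshold k κ ε with hβ
  refine plantedLaw_real_le hkn (measurable_coherenceTest k β (MeasurableSet.singleton false))
    fun C hC θ => ?_
  have hcard : (edgesIn C).card = k.choose 2 := by rw [card_edgesIn, hC]
  -- The gap between the planted mean m A(κ) of the projected sum and the threshold.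
  set t := ε / 4 * k.choose 2 * ratioA κ with ht
  have ht0 : 0 ≤ t := by positivity
  have hsub : {X : Obs n | coherenceTest k β X = false} ⊆
      {X | t ≤ ∑ e ∈ edgesIn C, (ratioA κ - Real.cos (X e - θ))} := by
    intro X hX
    have hX' : coherenceTest k β X = false := hX
    have hlt : ‖∑ e ∈ edgesIn C, Complex.exp (Complex.I * (X e : ℂ))‖ < β := by
      by_contra! hcon
      rw [(coherenceTest_eq_true_iff hkn).2 ⟨C, hC, hcon⟩] at hX'
      simp at hX'
    have h1 := (sum_cos_le_norm (edgesIn C) X θ).trans hlt.le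
    change t ≤ ∑ e ∈ edgesIn C, (ratioA κ - Real.cos (X e - θ))
    rw [Finset.sum_sub_distrib, Finset.sum_const, hcard, nsmul_eq_mul]
    rw [hβ, coherenceThreshold] at h1
    rw [ht]
    linarith
  refine (measureReal_mono hsub (measure_ne_top _ _)).trans ?_
  have := measure_pi_sum_ge_le
    (μ := fun e : Edge n => if e ∈ edgesIn C then vonMises θ κ else uniformAngle)
    (f := fun x => ratioA κ - Real.cos (x - θ)) (by fun_prop) (s := edgesIn C) (c := 1)
    (fun e he => by simpa [he] using hasSubgaussianMGF_cos_vonMises θ κ) ht0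
  refine this.trans_eq ?_
  rw [coherenceMissBound, hcard, ht]
  congr 1
  rcases eq_or_ne (k.choose 2 : ℝ) 0 with h | h
  · simp [h]
  · push_cast
    field_simp
    ring

/-! ### Likelihood ratios and their second moments -/

/-- The density of the von Mises law with respect to the uniform law. -/
noncomputable def relDensity (κ θ x : ℝ) : ℝ := Real.exp (κ * Real.cos (x - θ)) / besselI0 κ

theorem relDensity_nonneg (κ θ x : ℝ) : 0 ≤ relDensity κ θ x :=
  div_nonneg (Real.exp_pos _).le (besselI0_pos κ).le

theorem relDensity_le (κ θ x : ℝ) : relDensity κ θ x ≤ Real.exp |κ| / besselI0 κ := by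
  have := besselI0_pos κ
  unfold relDensity
  gcongr
  calc _ ≤ |κ * Real.cos (x - θ)| := le_abs_self _
    _ = |κ| * |Real.cos (x - θ)| := abs_mul _ _
    _ ≤ |κ| * 1 := by gcongr; exact Real.abs_cos_le_one _
    _ = _ := mul_one _

theorem integral_vonMises_eq_uniform (θ κ : ℝ) (f : ℝ → ℝ) :
    ∫ x, f x ∂(vonMises θ κ) = ∫ x, relDensity κ θ x * f x ∂uniformAngle := by
  rw [integral_vonMises, integral_uniformAngle, ← intervalIntegral.integral_const_mul]
  refine intervalIntegral.integral_congr fun x _ => ?_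
  have := besselI0_pos κ
  simp only [vonMisesDensity, relDensity]
  field_simp

theorem integral_relDensity (κ θ : ℝ) : ∫ x, relDensity κ θ x ∂uniformAngle = 1 := by
  have := integral_vonMises_eq_uniform θ κ fun _ => 1
  simpa using this.symm

theorem integral_exp_cos_uniform (c θ : ℝ) :
    ∫ x, Real.exp (c * Real.cos (x - θ)) ∂uniformAngle = besselI0 c := by
  rw [integral_uniformAngle, besselI0,
    ← integral_period_shift (periodic_comp_cos fun x => Real.exp (c * x)) (-θ)]
  simp [sub_eq_add_neg]

theorem integrable_uniformAngle {f : ℝ → ℝ} (hf : Continuous f) : Integrable f uniformAngle := by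
  have h : IntegrableOn f (Set.Ico 0 (2 * Real.pi)) :=
    (hf.integrableOn_Icc).mono_set Set.Ico_subset_Icc_self
  refine Integrable.smul_measure h ?_
  have : (0 : ℝ) < 2 * Real.pi := by positivity
  simpa using this

/-- By ab ≤ (a² + b²)/2 the product splits into two squares, each with mean R(κ) by rotation
invariance. The bound is independent of the phases, so the phase average needs no further work. -/
theorem integral_relDensity_mul_le (κ θ θ' : ℝ) :
    ∫ x, relDensity κ θ x * relDensity κ θ' x ∂uniformAngle ≤ ratioR κ := by
  have hI := besselI0_pos κ
  calc _ ≤ ∫ x, (Real.exp (2 * κ * Real.cos (x - θ)) + Real.exp (2 * κ * Real.cos (x - θ')))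
          / 2 / besselI0 κ ^ 2 ∂uniformAngle := by
        refine integral_mono (integrable_uniformAngle ?_) (integrable_uniformAngle (by fun_prop))
          fun x => ?_
        · unfold relDensity; fun_prop
        · simp only [relDensity]
          rw [div_mul_div_comm, ← sq]
          gcongr
          have h : ∀ y, Real.exp (2 * κ * y) = Real.exp (κ * y) ^ 2 := fun y => by
            rw [← Real.exp_nat_mul]; congr 1; push_cast; ring
          rw [h, h]
          nlinarith [sq_nonneg (Real.exp (κ * Real.cos (x - θ)) - Real.exp (κ * Real.cos (x - θ')))]
    _ = ratioR κ := by
        rw [integral_div, integral_div, integral_add (integrable_uniformAngle (by fun_prop))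
          (integrable_uniformAngle (by fun_prop)), integral_exp_cos_uniform,
          integral_exp_cos_uniform, ratioR]
        ring

/-- The relative density has mean 1, and its variance is nonnegative. -/
theorem one_le_ratioR (κ : ℝ) : 1 ≤ ratioR κ := by
  have h : 0 ≤ ∫ x, (relDensity κ 0 x - 1) ^ 2 ∂uniformAngle :=
    integral_nonneg fun x => sq_nonneg _
  have hc : Continuous (relDensity κ 0) := by unfold relDensity; fun_prop
  have e : ∀ x, (relDensity κ 0 x - 1) ^ 2
      = relDensity κ 0 x * relDensity κ 0 x - 2 * relDensity κ 0 x + 1 := fun x => by ring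
  simp only [e] at h
  rw [integral_add (integrable_uniformAngle (by fun_prop)) (integrable_const _),
    integral_sub (integrable_uniformAngle (by fun_prop)) (integrable_uniformAngle (by fun_prop)),
    integral_const_mul, integral_relDensity] at h
  have h2 := integral_relDensity_mul_le κ 0 0
  simp at h
  linarith

/-- The likelihood ratio given the community and the phase. -/
noncomputable def likelihoodGiven {n : ℕ} (C : Finset (Fin n)) (κ θ : ℝ) (X : Obs n) : ℝ :=
  ∏ e, if e ∈ edgesIn C then relDensity κ θ (X e) else 1

theorem continuous_likelihoodGiven {n : ℕ} (C : Finset (Fin n)) (κ : ℝ) :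
    Continuous fun p : ℝ × Obs n => likelihoodGiven C κ p.1 p.2 := by
  unfold likelihoodGiven
  refine continuous_finsetProd _ fun e _ => ?_
  split_ifs
  · unfold relDensity; fun_prop
  · fun_prop

theorem likelihoodGiven_nonneg {n : ℕ} (C : Finset (Fin n)) (κ θ : ℝ) (X : Obs n) :
    0 ≤ likelihoodGiven C κ θ X := by
  refine Finset.prod_nonneg fun e _ => ?_
  split_ifs
  exacts [relDensity_nonneg _ _ _, zero_le_one]

theorem exists_likelihoodGiven_le {n : ℕ} (C : Finset (Fin n)) (κ : ℝ) :
    ∃ M, ∀ θ X, likelihoodGiven C κ θ X ≤ M := by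
  refine ⟨∏ e, if e ∈ edgesIn C then Real.exp |κ| / besselI0 κ else 1, fun θ X => ?_⟩
  refine Finset.prod_le_prod (fun e _ => ?_) fun e _ => ?_
  · split_ifs
    exacts [relDensity_nonneg _ _ _, zero_le_one]
  · split_ifs
    exacts [relDensity_le _ _ _, le_rfl]

theorem measurable_likelihoodGiven {n : ℕ} (C : Finset (Fin n)) (κ θ : ℝ) :
    Measurable (likelihoodGiven C κ θ) :=
  ((continuous_likelihoodGiven C κ).comp (by fun_prop : Continuous fun X => (θ, X))).measurable

theorem integrable_likelihoodGiven {n : ℕ} (C : Finset (Fin n)) (κ θ : ℝ) :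
    Integrable (likelihoodGiven C κ θ) (nullLaw n) := by
  obtain ⟨M, hM⟩ := exists_likelihoodGiven_le C κ
  refine Integrable.of_bound (measurable_likelihoodGiven C κ θ).aestronglyMeasurable M
    (Eventually.of_forall fun X => ?_)
  rw [Real.norm_of_nonneg (likelihoodGiven_nonneg _ _ _ _)]
  exact hM θ X

/-- It suffices to compare the measures on boxes, where density times indicator is a product over
edges. -/
theorem plantedLawGiven_eq_withDensity {n : ℕ} (C : Finset (Fin n)) (κ θ : ℝ) :
    plantedLawGiven C κ θ
      = (nullLaw n).withDensity fun X => ENNReal.ofReal (likelihoodGiven C κ θ X) := by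
  refine Measure.pi_eq fun s hs => ?_
  rw [withDensity_apply _ (MeasurableSet.univ_pi hs),
    ← ofReal_integral_eq_lintegral_ofReal (integrable_likelihoodGiven C κ θ).integrableOn
      (Eventually.of_forall fun X => likelihoodGiven_nonneg _ _ _ _),
    ← integral_indicator (MeasurableSet.univ_pi hs)]
  have h1 : (Set.univ.pi s).indicator (likelihoodGiven C κ θ) = fun X => ∏ e,
      (if e ∈ edgesIn C then relDensity κ θ (X e) else 1) * (s e).indicator 1 (X e) := by
    ext X
    rw [Finset.prod_mul_distrib]
    by_cases hX : X ∈ Set.univ.pi s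
    · rw [Set.indicator_of_mem hX, Finset.prod_eq_one (f := fun e => (s e).indicator 1 (X e)),
        mul_one]
      · rfl
      · intro e _
        simp [hX e (Set.mem_univ e)]
    · rw [Set.indicator_of_notMem hX]
      simp only [Set.mem_univ_pi, not_forall] at hX
      obtain ⟨e, he⟩ := hX
      rw [Finset.prod_eq_zero (f := fun e => (s e).indicator 1 (X e)) (Finset.mem_univ e),
        mul_zero]
      simp [he]
  rw [h1, nullLaw, integral_fintype_prod_eq_prod (fun (e : Edge n) x =>
    (if e ∈ edgesIn C then relDensity κ θ x else 1) * (s e).indicator 1 x),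
    ENNReal.ofReal_prod_of_nonneg]
  · refine Finset.prod_congr rfl fun e _ => ?_
    split_ifs with he
    · rw [← integral_vonMises_eq_uniform, integral_indicator_one (hs e), ofReal_measureReal]
    · simp only [one_mul]
      rw [integral_indicator_one (hs e), ofReal_measureReal]
  · intro e _
    refine integral_nonneg fun x => mul_nonneg ?_ (Set.indicator_nonneg (by simp) x)
    split_ifs
    exacts [relDensity_nonneg _ _ _, zero_le_one]

theorem plantedLawGiven_real_eq_setIntegral {n : ℕ} (C : Finset (Fin n)) (κ θ : ℝ)
    {s : Set (Obs n)} (hs : MeasurableSet s) :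
    (plantedLawGiven C κ θ).real s = ∫ X in s, likelihoodGiven C κ θ X ∂(nullLaw n) := by
  rw [plantedLawGiven_eq_withDensity, measureReal_def, withDensity_apply _ hs,
    ← ofReal_integral_eq_lintegral_ofReal (integrable_likelihoodGiven C κ θ).integrableOn
      (Eventually.of_forall fun X => likelihoodGiven_nonneg _ _ _ _),
    ENNReal.toReal_ofReal (integral_nonneg fun X => likelihoodGiven_nonneg _ _ _ _)]

theorem integral_likelihoodGiven {n : ℕ} (C : Finset (Fin n)) (κ θ : ℝ) :
    ∫ X, likelihoodGiven C κ θ X ∂(nullLaw n) = 1 := by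
  have := plantedLawGiven_real_eq_setIntegral C κ θ MeasurableSet.univ
  simpa using this.symm

/-- By independence the integral is a product over edges: at most R(κ) for an edge in both
communities, and exactly 1 for any other, since each density has mean 1. -/
theorem integral_likelihoodGiven_mul_le {n : ℕ} (C D : Finset (Fin n)) (κ θ θ' : ℝ) :
    ∫ X, likelihoodGiven C κ θ X * likelihoodGiven D κ θ' X ∂(nullLaw n)
      ≤ ratioR κ ^ ((C ∩ D).card.choose 2) := by
  simp only [likelihoodGiven, ← Finset.prod_mul_distrib]
  rw [nullLaw, integral_fintype_prod_eq_prod (fun (e : Edge n) x =>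
    (if e ∈ edgesIn C then relDensity κ θ x else 1)
      * (if e ∈ edgesIn D then relDensity κ θ' x else 1))]
  have hnn : ∀ (E : Finset (Fin n)) (φ : ℝ) (e : Edge n) (x : ℝ),
      0 ≤ if e ∈ edgesIn E then relDensity κ φ x else 1 := by
    intro E φ e x
    split_ifs
    exacts [relDensity_nonneg _ _ _, zero_le_one]
  calc _ ≤ ∏ e : Edge n, if e ∈ edgesIn (C ∩ D) then ratioR κ else 1 := by
        refine Finset.prod_le_prod
          (fun e _ => integral_nonneg fun x => mul_nonneg (hnn _ _ _ _) (hnn _ _ _ _))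
          fun e _ => ?_
        simp only [edgesIn_inter, Finset.mem_inter]
        by_cases hC : e ∈ edgesIn C <;> by_cases hD : e ∈ edgesIn D <;> simp only [hC, hD, if_true,
          if_false, and_self, and_true, and_false, mul_one, one_mul]
        · exact integral_relDensity_mul_le κ θ θ'
        · exact (integral_relDensity κ θ).le
        · exact (integral_relDensity κ θ').le
        · simp
    _ = _ := by
        rw [Finset.prod_ite, Finset.prod_const, Finset.prod_const_one, mul_one,
          Finset.filter_univ_mem, card_edgesIn]

/-- Second-moment bound for a mixture of laws with bounded densities. -/
theorem mixture_measure_le {Ω T : Type*} [MeasurableSpace Ω] [MeasurableSpace T] {Q : Measure Ω}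
    [IsProbabilityMeasure Q] {ν : Measure T} [IsProbabilityMeasure ν] {l : T → Ω → ℝ}
    (hl : Measurable (Function.uncurry l)) {M : ℝ} (h0 : ∀ t x, 0 ≤ l t x) (hM : ∀ t x, l t x ≤ M)
    (h1 : ∀ t, ∫ x, l t x ∂Q = 1) {η : ℝ} (h2 : ∀ t t', ∫ x, l t x * l t' x ∂Q ≤ 1 + η)
    {A : Set Ω} (hA : MeasurableSet A) {s : ℝ} (hs : 0 < s) :
    ∫ t, (∫ x in A, l t x ∂Q) ∂ν ≤ Q.real A + (η / (4 * s) + s) := by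
  have hint : ∀ m : Measure Ω, IsFiniteMeasure m →
      Integrable (Function.uncurry l) (ν.prod m) := fun m _ =>
    Integrable.of_bound hl.aestronglyMeasurable M (Eventually.of_forall fun z => by
      change ‖l z.1 z.2‖ ≤ M
      rw [Real.norm_of_nonneg (h0 _ _)]; exact hM _ _)
  set L : Ω → ℝ := fun x => ∫ t, l t x ∂ν with hL
  have hL0 : ∀ x, 0 ≤ L x := fun x => integral_nonneg fun t => h0 t x
  have hLM : ∀ x, L x ≤ M := fun x => by
    have h : Integrable (fun t => l t x) ν :=
      Integrable.of_bound (hl.comp measurable_prodMk_right).aestronglyMeasurable M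
        (Eventually.of_forall fun t => by rw [Real.norm_of_nonneg (h0 _ _)]; exact hM _ _)
    calc L x ≤ ∫ _, M ∂ν := integral_mono h (integrable_const _) fun t => hM t x
      _ = M := by simp
  have hLmeas : Measurable L :=
    (StronglyMeasurable.integral_prod_left hl.stronglyMeasurable).measurable
  have hLint : Integrable L Q := Integrable.of_bound hLmeas.aestronglyMeasurable M
    (Eventually.of_forall fun x => by rw [Real.norm_of_nonneg (hL0 _)]; exact hLM x)
  have hL2int : Integrable (fun x => L x ^ 2) Q :=
    Integrable.of_bound (hLmeas.pow_const 2).aestronglyMeasurable (M ^ 2)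
      (Eventually.of_forall fun x => by
        rw [Real.norm_of_nonneg (sq_nonneg _)]
        exact pow_le_pow_left₀ (hL0 x) (hLM x) 2)
  have hmean : ∫ x, L x ∂Q = 1 := by
    rw [hL, ← integral_integral_swap (hint Q inferInstance)]
    simp [h1]
  have hsecond : ∫ x, L x ^ 2 ∂Q ≤ 1 + η := by
    -- Two independent replicas of the mixing variable express the square, so Fubini reduces it to
    -- the pairwise bound.
    have e : ∀ x, L x ^ 2 = ∫ z : T × T, l z.1 x * l z.2 x ∂(ν.prod ν) := fun x => by
      rw [integral_prod_mul (fun t => l t x) (fun t => l t x), sq]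
    have hm : Measurable (Function.uncurry fun (z : T × T) x => l z.1 x * l z.2 x) :=
      (hl.comp (by fun_prop : Measurable fun p : (T × T) × Ω => (p.1.1, p.2))).mul
        (hl.comp (by fun_prop : Measurable fun p : (T × T) × Ω => (p.1.2, p.2)))
    have hi : Integrable (Function.uncurry fun (z : T × T) x => l z.1 x * l z.2 x)
        ((ν.prod ν).prod Q) :=
      Integrable.of_bound hm.aestronglyMeasurable (M * M) (Eventually.of_forall fun p => by
        change ‖l p.1.1 p.2 * l p.1.2 p.2‖ ≤ M * M
        rw [Real.norm_of_nonneg (mul_nonneg (h0 _ _) (h0 _ _))]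
        exact mul_le_mul (hM _ _) (hM _ _) (h0 _ _) ((h0 _ _).trans (hM p.1.1 p.2)))
    simp only [e]
    rw [← integral_integral_swap hi]
    calc _ ≤ ∫ _ : T × T, (1 + η) ∂(ν.prod ν) :=
          integral_mono hi.integral_prod_left (integrable_const _) fun z => h2 z.1 z.2
      _ = _ := by simp
  have hswap : ∫ t, (∫ x in A, l t x ∂Q) ∂ν = ∫ x in A, L x ∂Q :=
    integral_integral_swap (hint (Q.restrict A) inferInstance)
  have i1 : Integrable (A.indicator (1 : Ω → ℝ)) Q := (integrable_const 1).indicator hA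
  have i2 : Integrable (fun x => L x ^ 2 - 2 * L x) Q := hL2int.sub (hLint.const_mul 2)
  have i3 : Integrable (fun x => L x ^ 2 - 2 * L x + 1) Q := i2.add (integrable_const 1)
  have i4 : Integrable (fun x => (L x ^ 2 - 2 * L x + 1) / (4 * s)) Q := i3.div_const _
  have i5 : Integrable (fun x => (L x ^ 2 - 2 * L x + 1) / (4 * s) + s) Q :=
    i4.add (integrable_const s)
  rw [hswap, ← integral_indicator hA]
  calc ∫ x, A.indicator L x ∂Q
      ≤ ∫ x, (A.indicator 1 x + ((L x ^ 2 - 2 * L x + 1) / (4 * s) + s)) ∂Q := by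
        refine integral_mono (hLint.indicator hA) (i1.add i5) fun x => ?_
        · have hq : 0 ≤ (L x ^ 2 - 2 * L x + 1) / (4 * s) := by
            have : L x ^ 2 - 2 * L x + 1 = (L x - 1) ^ 2 := by ring
            rw [this]; positivity
          by_cases hx : x ∈ A
          · simp only [Set.indicator_of_mem hx, Pi.one_apply]
            -- This is (L - 1 - 2s)² ≥ 0; it replaces the Cauchy-Schwarz inequality and keeps s
            -- free.
            have : L x - 1 - s ≤ (L x ^ 2 - 2 * L x + 1) / (4 * s) := by
              rw [le_div_iff₀ (by positivity)]
              nlinarith [sq_nonneg (L x - 1 - 2 * s)]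
            linarith
          · simp only [Set.indicator_of_notMem hx]
            linarith
    _ = Q.real A + ((∫ x, L x ^ 2 ∂Q - 2 * ∫ x, L x ∂Q + 1) / (4 * s) + s) := by
        rw [integral_add i1 i5, integral_indicator_one hA, integral_add i4 (integrable_const s),
          integral_div, integral_add i2 (integrable_const 1),
          integral_sub hL2int (hLint.const_mul 2), integral_const_mul]
        simp
    _ ≤ _ := by
        rw [hmean]
        gcongr
        linarith

/-! ### The overlap of two random communities -/

/-- A fixed j-set lies in a random k-subset with probability ∏ (k - i)/(n - i) over i < j, and each
factor is at most k/n. -/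
theorem choose_sub_le {n k j : ℕ} (hkn : k ≤ n) (hjk : j ≤ k) :
    ((n - j).choose (k - j) : ℝ) ≤ n.choose k * ((k : ℝ) / n) ^ j := by
  induction j with
  | zero => simp
  | succ j ih =>
    have ih := ih (by omega)
    have hn0 : (0 : ℝ) < n := by exact_mod_cast (by omega : 0 < n)
    have hnj : (0 : ℝ) < (n : ℝ) - j := by
      have : (j : ℝ) + 1 ≤ n := by exact_mod_cast hjk.trans hkn
      linarith
    have hid : ((n : ℝ) - j) * ((n - (j + 1)).choose (k - (j + 1)) : ℝ)
        = ((n - j).choose (k - j) : ℝ) * (k - j) := by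
      have h := Nat.add_one_mul_choose_eq (n - (j + 1)) (k - (j + 1))
      rw [show n - (j + 1) + 1 = n - j by omega, show k - (j + 1) + 1 = k - j by omega] at h
      have h' : (((n - j : ℕ) : ℝ)) * ((n - (j + 1)).choose (k - (j + 1)) : ℝ)
        = ((n - j).choose (k - j) : ℝ) * ((k - j : ℕ) : ℝ) := by exact_mod_cast h
      rwa [Nat.cast_sub (by omega), Nat.cast_sub (by omega)] at h'
    have hratio : ((k : ℝ) - j) / (n - j) ≤ k / n := by
      rw [div_le_div_iff₀ hnj hn0]
      have h1 : (k : ℝ) ≤ n := by exact_mod_cast hkn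
      have h2 : (0 : ℝ) ≤ j := by positivity
      nlinarith
    have hk0 : (0 : ℝ) ≤ (k : ℝ) - j := by
      have : (j : ℝ) + 1 ≤ k := by exact_mod_cast hjk
      linarith
    calc ((n - (j + 1)).choose (k - (j + 1)) : ℝ)
        = ((n - j).choose (k - j) : ℝ) * ((k - j) / (n - j)) := by
          rw [mul_div_assoc', eq_div_iff hnj.ne', ← hid, mul_comm]
      _ ≤ (n.choose k * ((k : ℝ) / n) ^ j) * (k / n) := by
          refine mul_le_mul ih hratio (div_nonneg hk0 hnj.le) (by positivity)
      _ = _ := by rw [pow_succ, mul_assoc]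

/-- The moment generating function of the hypergeometric overlap is at most the binomial one. -/
theorem sum_pow_card_inter_le {n k : ℕ} (hkn : k ≤ n) {x : ℝ} (hx : 1 ≤ x) {D : Finset (Fin n)}
    (hD : D.card = k) :
    ∑ C ∈ (Finset.univ : Finset (Fin n)).powersetCard k, x ^ (C ∩ D).card
      ≤ n.choose k * (1 + k / n * (x - 1)) ^ k := by
  have hx0 : 0 ≤ x - 1 := by linarith
  -- Expanding (1 + (x - 1))^|C ∩ D| over subsets J turns the sum over C into counts of the k-sets
  -- containing J, with coefficients nonnegative as x ≥ 1.
  have hexpand : ∀ C : Finset (Fin n), x ^ (C ∩ D).card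
      = ∑ J ∈ D.powerset, if J ⊆ C then (x - 1) ^ J.card else 0 := by
    intro C
    rw [← Finset.sum_filter]
    have h := Finset.sum_pow_mul_eq_add_pow (x - 1) 1 (C ∩ D)
    simp only [one_pow, mul_one, sub_add_cancel] at h
    rw [← h]
    refine Finset.sum_congr ?_ fun _ _ => rfl
    ext J
    simp only [Finset.mem_powerset, Finset.subset_inter_iff, Finset.mem_filter, and_comm]
  simp only [hexpand]
  rw [Finset.sum_comm]
  have hD' := Finset.sum_pow_mul_eq_add_pow ((k : ℝ) / n * (x - 1)) 1 D
  simp only [one_pow, mul_one, hD] at hD'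
  rw [add_comm 1, ← hD', Finset.mul_sum]
  refine Finset.sum_le_sum fun J hJ => ?_
  have hJk : J.card ≤ k := hD ▸ Finset.card_le_card (Finset.mem_powerset.1 hJ)
  rw [← Finset.sum_filter, Finset.sum_const,
    Finset.card_filter_powersetCard_subset _ _ _ (Finset.subset_univ J) hJk, nsmul_eq_mul, mul_pow,
    ← mul_assoc]
  simp only [Finset.card_univ, Fintype.card_fin]
  exact mul_le_mul_of_nonneg_right (choose_sub_le hkn hJk) (by positivity)

/-- Bounding s(s-1)/2 by s(k-1)/2 makes the exponent linear in the overlap, so a generating function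
applies. -/
theorem pow_choose_two_le {R : ℝ} (hR : 1 ≤ R) {s k : ℕ} (hs : s ≤ k) :
    R ^ (s.choose 2) ≤ Real.exp (((k : ℝ) - 1) * Real.log R / 2) ^ s := by
  have hlog : 0 ≤ Real.log R := Real.log_nonneg hR
  rw [← Real.exp_log (pow_pos (by linarith : 0 < R) _), Real.log_pow, ← Real.exp_nat_mul,
    Nat.cast_choose_two, Real.exp_le_exp]
  have h1 : (s : ℝ) ≤ k := by exact_mod_cast hs
  have : (s : ℝ) * (s - 1) ≤ s * (k - 1) := by gcongr
  nlinarith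

/-- The second moment of the likelihood ratio is controlled by the overlap of two communities. -/
theorem overlap_average_le {n k : ℕ} (hk : 1 ≤ k) (hkn : k ≤ n) (κ : ℝ) :
    ((n.choose k : ℝ))⁻¹ * ((n.choose k : ℝ))⁻¹ *
      ∑ D ∈ (Finset.univ : Finset (Fin n)).powersetCard k,
        ∑ C ∈ (Finset.univ : Finset (Fin n)).powersetCard k, ratioR κ ^ ((C ∩ D).card.choose 2)
      ≤ Real.exp ((k : ℝ) ^ 2 / n *
        (Real.exp (((k : ℝ) - 1) * Real.log (ratioR κ) / 2) - 1)) := by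
  have hR := one_le_ratioR κ
  set x := Real.exp (((k : ℝ) - 1) * Real.log (ratioR κ) / 2) with hx
  have hx1 : 1 ≤ x := by
    have h1 : (1 : ℝ) ≤ k := by exact_mod_cast hk
    have h2 : 0 ≤ Real.log (ratioR κ) := Real.log_nonneg hR
    rw [hx, Real.one_le_exp_iff]
    have := mul_nonneg (by linarith : 0 ≤ (k : ℝ) - 1) h2
    linarith
  have hN : (0 : ℝ) < n.choose k := by exact_mod_cast Nat.choose_pos hkn
  rw [← mul_inv, inv_mul_le_iff₀ (by positivity)]
  calc _ ≤ ∑ D ∈ (Finset.univ : Finset (Fin n)).powersetCard k,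
        (n.choose k * (1 + k / n * (x - 1)) ^ k : ℝ) := by
        refine Finset.sum_le_sum fun D hD => ?_
        have hDk := (Finset.mem_powersetCard.1 hD).2
        refine le_trans (Finset.sum_le_sum fun C _ => ?_) (sum_pow_card_inter_le hkn hx1 hDk)
        exact pow_choose_two_le hR (hDk ▸ Finset.card_le_card Finset.inter_subset_right)
    _ = n.choose k * n.choose k * (1 + k / n * (x - 1)) ^ k := by simp; ring
    _ ≤ n.choose k * n.choose k * Real.exp ((k : ℝ) ^ 2 / n * (x - 1)) := by
        have hnn : 0 ≤ (k : ℝ) / n * (x - 1) := mul_nonneg (by positivity) (by linarith)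
        have h : (1 + k / n * (x - 1) : ℝ) ^ k ≤ Real.exp (k / n * (x - 1)) ^ k :=
          pow_le_pow_left₀ (by linarith) (by linarith [Real.add_one_le_exp ((k : ℝ) / n * (x - 1))]) k
        rw [← Real.exp_nat_mul] at h
        refine mul_le_mul_of_nonneg_left (h.trans_eq ?_) (by positivity)
        congr 1; ring

/-! ### The converse -/

theorem isProbabilityMeasure_plantedLaw {n k : ℕ} (hkn : k ≤ n) (κ : ℝ) :
    IsProbabilityMeasure (plantedLaw n k κ) := by
  have hN : (n.choose k : ℝ) ≠ 0 := by exact_mod_cast (Nat.choose_pos hkn).ne'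
  have h := plantedLaw_real (n := n) (k := k) κ MeasurableSet.univ
  simp only [probReal_univ, integral_const, smul_eq_mul, mul_one, Finset.sum_const,
    Finset.card_powersetCard, Finset.card_univ, Fintype.card_fin, nsmul_eq_mul] at h
  rw [inv_mul_cancel₀ hN, measureReal_def, ENNReal.toReal_eq_one_iff] at h
  exact ⟨h⟩

theorem plantedLaw_real_le_nullLaw_add {n k : ℕ} (hk : 1 ≤ k) (hkn : k ≤ n) (κ : ℝ)
    {A : Set (Obs n)} (hA : MeasurableSet A) {s : ℝ} (hs : 0 < s) :
    (plantedLaw n k κ).real A ≤ (nullLaw n).real A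
      + ((Real.exp ((k : ℝ) ^ 2 / n *
        (Real.exp (((k : ℝ) - 1) * Real.log (ratioR κ) / 2) - 1)) - 1) / (4 * s) + s) := by
  have hN : (0 : ℝ) < n.choose k := by exact_mod_cast Nat.choose_pos hkn
  set S := (Finset.univ : Finset (Fin n)).powersetCard k with hS
  have hScard : S.card = n.choose k := by simp [hS]
  -- The community is averaged out here, so the phase remains as the only mixing variable.
  set l : ℝ → Obs n → ℝ := fun θ X =>
    (n.choose k : ℝ)⁻¹ * ∑ C ∈ S, likelihoodGiven C κ θ X with hl
  have hLHS : (plantedLaw n k κ).real A = ∫ θ, (∫ X in A, l θ X ∂(nullLaw n)) ∂uniformAngle := by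
    rw [plantedLaw_real κ hA, ← integral_finsetSum _
      fun C _ => integrable_plantedLawGiven_real C κ hA, ← integral_const_mul]
    refine integral_congr_ae (Eventually.of_forall fun θ => ?_)
    simp only [hl]
    rw [integral_const_mul, integral_finsetSum _
      fun C _ => (integrable_likelihoodGiven C κ θ).integrableOn]
    simp only [plantedLawGiven_real_eq_setIntegral _ κ θ hA, hS]
  choose M hM using fun C : Finset (Fin n) => exists_likelihoodGiven_le C κ
  rw [hLHS]
  refine mixture_measure_le (M := (n.choose k : ℝ)⁻¹ * ∑ C ∈ S, M C) ?_ ?_ ?_ ?_ ?_ hA hs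
  · refine Continuous.measurable ?_
    exact continuous_const.mul (continuous_finsetSum _ fun C _ => continuous_likelihoodGiven C κ)
  · exact fun θ X => mul_nonneg (by positivity)
      (Finset.sum_nonneg fun C _ => likelihoodGiven_nonneg C κ θ X)
  · exact fun θ X => mul_le_mul_of_nonneg_left (Finset.sum_le_sum fun C _ => hM C θ X)
      (by positivity)
  · intro θ
    simp only [hl]
    rw [integral_const_mul, integral_finsetSum _ fun C _ => integrable_likelihoodGiven C κ θ]
    simp only [integral_likelihoodGiven, Finset.sum_const, hScard, nsmul_eq_mul, mul_one]
    exact inv_mul_cancel₀ hN.ne'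
  · intro θ θ'
    have hint : ∀ C D, Integrable
        (fun X => likelihoodGiven C κ θ X * likelihoodGiven D κ θ' X) (nullLaw n) := by
      intro C D
      refine (integrable_likelihoodGiven C κ θ).mul_bdd (c := M D)
        (measurable_likelihoodGiven D κ θ').aestronglyMeasurable (Eventually.of_forall fun X => ?_)
      rw [Real.norm_of_nonneg (likelihoodGiven_nonneg _ _ _ _)]
      exact hM D θ' X
    have e : ∀ X, l θ X * l θ' X = (n.choose k : ℝ)⁻¹ * (n.choose k : ℝ)⁻¹ *
        ∑ D ∈ S, ∑ C ∈ S, likelihoodGiven C κ θ X * likelihoodGiven D κ θ' X := by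
      intro X
      simp only [hl]
      rw [Finset.sum_comm, ← Finset.sum_mul_sum]
      ring
    simp only [e]
    rw [integral_const_mul, integral_finsetSum _
      fun D _ => integrable_finsetSum _ fun C _ => hint C D, add_sub_cancel]
    refine le_trans ?_ (overlap_average_le hk hkn κ)
    refine mul_le_mul_of_nonneg_left (Finset.sum_le_sum fun D _ => ?_) (by positivity)
    rw [integral_finsetSum _ fun C _ => hint C D]
    exact Finset.sum_le_sum fun C _ => integral_likelihoodGiven_mul_le C D κ θ θ'

theorem weakDetectionImpossible_of_tendsto {k : ℕ → ℕ} {κ : ℕ → ℝ}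
    (hk : ∀ᶠ n in atTop, 1 ≤ k n ∧ k n ≤ n ∧ 0 < κ n)
    (h : Tendsto (fun n : ℕ => (k n : ℝ) ^ 2 / n *
      (Real.exp (((k n : ℝ) - 1) * Real.log (ratioR (κ n)) / 2) - 1)) atTop (𝓝 0)) :
    WeakDetectionImpossible nullLaw (fun n => plantedLaw n (k n) (κ n)) := by
  intro φ hφ δ hδ
  have h1 : Tendsto (fun n : ℕ => Real.exp ((k n : ℝ) ^ 2 / n *
      (Real.exp (((k n : ℝ) - 1) * Real.log (ratioR (κ n)) / 2) - 1)) - 1) atTop (𝓝 0) := by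
    have := ((Real.continuous_exp.tendsto 0).comp h).sub_const 1
    simpa using this
  -- With s = δ/2, the error η/(4s) + s is at most δ as soon as η ≤ δ².
  filter_upwards [hk, h1.eventually (gt_mem_nhds (by positivity : 0 < δ ^ 2))] with n hn hsmall
  have := isProbabilityMeasure_plantedLaw hn.2.1 (κ n)
  have hA : MeasurableSet {X | φ n X = true} := hφ n (MeasurableSet.singleton true)
  have hbound := plantedLaw_real_le_nullLaw_add hn.1 hn.2.1 (κ n) hA (s := δ / 2) (by positivity)
  have hc : {X | φ n X = false} = {X | φ n X = true}ᶜ := by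
    ext X; simp
  rw [pFalseAlarm, pMiss, hc, probReal_compl_eq_one_sub hA]
  have hq : (Real.exp ((k n : ℝ) ^ 2 / n *
      (Real.exp (((k n : ℝ) - 1) * Real.log (ratioR (κ n)) / 2) - 1)) - 1) / (4 * (δ / 2))
      ≤ δ / 2 := by
    rw [div_le_iff₀ (by positivity)]
    nlinarith
  linarith

end VonMisesCommunity

theorem theorem4 :
    -- (a) interval test: explicit error bounds
    (∀ (n k : ℕ) (κ τ : ℝ), 2 ≤ k → k ≤ n → 0 < κ → 0 < τ → τ < 1 →
      pFalseAlarm (nullLaw n) (intervalTest k τ) ≤ intervalFABound n k τ ∧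
      pMiss (plantedLaw n k κ) (intervalTest k τ) ≤ intervalMissBound k κ τ) ∧
    -- (a) interval test: strong detection when both bounds vanish
    (∀ (k : ℕ → ℕ) (κ τ : ℕ → ℝ),
      (∀ᶠ n in atTop, 2 ≤ k n ∧ k n ≤ n ∧ 0 < κ n ∧ 0 < τ n ∧ τ n < 1) →
      Tendsto (fun n => intervalFABound n (k n) (τ n)) atTop (𝓝 0) →
      Tendsto (fun n => intervalMissBound (k n) (κ n) (τ n)) atTop (𝓝 0) →
      AchievesStrongDetection nullLaw (fun n => plantedLaw n (k n) (κ n))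
        (fun n => intervalTest (k n) (τ n))) ∧
    -- (a) coherence test: explicit error bounds
    (∀ (n k : ℕ) (κ : ℝ) (B : ℕ) (ε : ℝ), 1 ≤ k → k ≤ n → 0 < κ → 3 ≤ B → 0 < ε → ε < 1 →
      pFalseAlarm (nullLaw n) (coherenceTest k (coherenceThreshold k κ ε))
        ≤ coherenceFABound n k κ B ε ∧
      pMiss (plantedLaw n k κ) (coherenceTest k (coherenceThreshold k κ ε))
        ≤ coherenceMissBound k κ ε) ∧
    -- (a) coherence test: strong detection when both bounds vanish
    (∀ (k : ℕ → ℕ) (κ : ℕ → ℝ) (B : ℕ → ℕ) (ε : ℕ → ℝ),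
      (∀ᶠ n in atTop, 1 ≤ k n ∧ k n ≤ n ∧ 0 < κ n ∧ 3 ≤ B n ∧ 0 < ε n ∧ ε n < 1) →
      Tendsto (fun n => coherenceFABound n (k n) (κ n) (B n) (ε n)) atTop (𝓝 0) →
      Tendsto (fun n => coherenceMissBound (k n) (κ n) (ε n)) atTop (𝓝 0) →
      AchievesStrongDetection nullLaw (fun n => plantedLaw n (k n) (κ n))
        (fun n => coherenceTest (k n) (coherenceThreshold (k n) (κ n) (ε n)))) ∧
    -- (b) converse
    (∀ (k : ℕ → ℕ) (κ : ℕ → ℝ),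
      (∀ᶠ n in atTop, 1 ≤ k n ∧ k n ≤ n ∧ 0 < κ n) →
      Tendsto (fun n : ℕ => (k n : ℝ) ^ 2 / n *
        (Real.exp (((k n : ℝ) - 1) * Real.log (ratioR (κ n)) / 2) - 1)) atTop (𝓝 0) →
      WeakDetectionImpossible nullLaw (fun n => plantedLaw n (k n) (κ n))) := by
  refine ⟨fun n k κ τ hk hkn hκ h0 h1 =>
      ⟨pFalseAlarm_intervalTest_le hk hkn h0 h1, pMiss_intervalTest_le hkn hκ h0 h1⟩,
    fun k κ τ hev hfa hmiss => ⟨fun n => measurable_intervalTest _ _,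
      tendsto_of_tendsto_of_tendsto_of_le_of_le' tendsto_const_nhds hfa
        (Eventually.of_forall fun _ => measureReal_nonneg) ?_,
      tendsto_of_tendsto_of_tendsto_of_le_of_le' tendsto_const_nhds hmiss
        (Eventually.of_forall fun _ => measureReal_nonneg) ?_⟩,
    fun n k κ B ε hk hkn hκ hB h0 h1 =>
      ⟨pFalseAlarm_coherenceTest_le hk hkn hκ hB h1, pMiss_coherenceTest_le hkn hκ h0⟩,
    fun k κ B ε hev hfa hmiss => ⟨fun n => measurable_coherenceTest _ _,
      tendsto_of_tendsto_of_tendsto_of_le_of_le' tendsto_const_nhds hfa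
        (Eventually.of_forall fun _ => measureReal_nonneg) ?_,
      tendsto_of_tendsto_of_tendsto_of_le_of_le' tendsto_const_nhds hmiss
        (Eventually.of_forall fun _ => measureReal_nonneg) ?_⟩,
    fun k κ hk h => weakDetectionImpossible_of_tendsto hk h⟩
  · filter_upwards [hev] with n ⟨hk, hkn, _, h0, h1⟩
    exact pFalseAlarm_intervalTest_le hk hkn h0 h1
  · filter_upwards [hev] with n ⟨_, hkn, hκ, h0, h1⟩
    exact pMiss_intervalTest_le hkn hκ h0 h1
  · filter_upwards [hev] with n ⟨hk, hkn, hκ, hB, _, h1⟩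
    exact pFalseAlarm_coherenceTest_le hk hkn hκ hB h1
  · filter_upwards [hev] with n ⟨_, hkn, hκ, _, h0, _⟩
    exact pMiss_coherenceTest_le hkn hκ h0
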